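/- All digraphs are finite, simple (no loops and no multiple arcs; a pair of opposite arcs between two vertices is allowed) and strongly connected. For vertices $x,y$ of a digraph $\Gamma$, let $\partial(x,y)$ be the length of a shortest directed path from $x$ to $y$, and let $\tilde\partial(x,y)=(\partial(x,y),\partial(y,x))$. A set $S$ of vertices of $\Gamma$ is weakly resolving if for any two distinct vertices $u,v$ there is $w\in S$ with $\tilde\partial(w,u)\neq\tilde\partial(w,v)$; the weak metric dimension of $\Gamma$ is the minimum cardinality of a weakly resolving set. The digraph $\Gamma$ is vertex-transitive if its automorphism group acts transitively on its vertices. For a finite additive group $G$ and $S\subseteq G$, $\mathrm{Cay}(G,S)$ denotes the digraph with vertex set $G$ and arc set $\{(x,x+s)\mid x\in G,\ s\in S\}$. **Theorem.** A vertex-transitive digraph $\Gamma$ of order at least $2$ has weak metric dimension $1$ if and only if $\Gamma$ is isomorphic to one of the following digraphs: (i) $\mathrm{Cay}(\mathbb{Z}_n,\{1\})$, where $n\geq 2$; (ii) $\mathrm{Cay}(\mathbb{Z}_{2n},\{1,2\})$, where $n\geq 2$; (iii) $\mathrm{Cay}(\mathbb{Z}_2\oplus\mathbb{Z}_n,\{(1,0),(0,1)\})$,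 where $n\geq 3$; (iv) $\mathrm{Cay}(\mathbb{Z}_2\oplus\mathbb{Z}_{2n},\{(1,0),(0,1),(0,2)\})$, where $n\geq 3$. -/

import Mathlib

namespace Digraph

/-- `Γ.HasWalk n x y`: there is a directed walk with exactly `n` arcs from `x` to `y`. -/
def HasWalk {V : Type*} (Γ : Digraph V) : ℕ → V → V → Prop
  | 0, x, y => x = y
  | n + 1, x, y => ∃ z, Γ.HasWalk n x z ∧ Γ.Adj z y

/-- Every vertex can be reached from every vertex by a directed walk (equivalently, a directed
path). -/
def StronglyConnected {V : Type*} (Γ : Digraph V) : Prop :=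
  ∀ x y, ∃ n, Γ.HasWalk n x y

/-- The distance from `x` to `y`: the length of a shortest directed walk from `x` to `y`; such a
walk is automatically a path. It is meaningful when `y` is reachable from `x`, in particular in
strongly connected digraphs. -/
noncomputable def dist {V : Type*} (Γ : Digraph V) (x y : V) : ℕ :=
  sInf {n | Γ.HasWalk n x y}

/-- The two way distance `(∂(x, y), ∂(y, x))`. -/
noncomputable def twoWayDist {V : Type*} (Γ : Digraph V) (x y : V) : ℕ × ℕ :=
  (Γ.dist x y, Γ.dist y x)

/-- `S` is a weakly resolving set: any two distinct vertices `u`, `v` have different vectors of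
two way distances from the members of `S`. -/
def IsWeaklyResolving {V : Type*} (Γ : Digraph V) (S : Finset V) : Prop :=
  ∀ u v, u ≠ v → ∃ w ∈ S, Γ.twoWayDist w u ≠ Γ.twoWayDist w v

/-- The weak metric dimension: the minimum cardinality of a weakly resolving set. (On a finite
vertex set of a strongly connected digraph, the set of all vertices is weakly resolving.) -/
noncomputable def weakMetricDim {V : Type*} (Γ : Digraph V) : ℕ :=
  sInf {k | ∃ S : Finset V, S.card = k ∧ Γ.IsWeaklyResolving S}

/-- Isomorphism of digraphs: a bijection of the vertex sets that preserves and reflects arcs. -/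
def IsIsomorphic {V W : Type*} (Γ : Digraph V) (Δ : Digraph W) : Prop :=
  Nonempty (Γ.Adj ≃r Δ.Adj)

/-- The automorphism group acts transitively on the vertices. -/
def IsVertexTransitive {V : Type*} (Γ : Digraph V) : Prop :=
  ∀ x y, ∃ σ : Γ.Adj ≃r Γ.Adj, σ x = y

/-- The Cayley digraph `Cay(G, S)` of an additively written group `G`: its arcs are the pairs
`(x, x + s)` with `x ∈ G` and `s ∈ S`. -/
def addCayley {G : Type*} [AddGroup G] (S : Set G) : Digraph G where
  Adj x y := ∃ s ∈ S, y = x + s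

end Digraph

/-!
If a single vertex `w` of a vertex-transitive digraph `Γ` is weakly resolving, an automorphism fixing
`w` is the identity. Hence `Γ` is a Cayley digraph `Cay(A, S)` of its automorphism group `A`, and the
hypothesis says that `g ∈ A` is determined by the pair consisting of the word length of `g` with
respect to `S` and the word length of `-g` (`IsThin`). In particular there is at most one element of
`S`, and at most one sum of two letters outside `S` and `0`, for each value of the word length of
`-g`. This pigeonhole principle, applied to closed words (words with sum `0`) of extremal length, is
the engine of the whole proof.

*Commutativity.* Take a shortest closed word with two noncommuting neighbours. All noncommuting
neighbours in such words have the same sum, which is not a letter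
(`IsThin.add_notMem_of_not_addCommute`). Given this, the word can be rearranged as `ζ + x + m • y`
with `ζ` commuting with the noncommuting letters `x`, `y`, which is absurd
(`IsThin.not_closed_of_not_addCommute`).

*Abelian groups.* At most one letter is an involution. A pair `a`, `b = 2a` of letters like the pair
`1`, `2` in `ℤ₂ₙ` is called a block (`IsBlock`), and distinct letters that are not involutions and
do not form a block are called far. In a shortest closed word containing a far pair `u`, `v` all far
pairs have sums at the same distance to `0`, so that there are at most two such sums; this rules out
a third letter other than an involution (`IsThin.le_of_third_letter`), and the word is
`(x + 1) • u + (y + 1) • v + f` with `f` zero or an involution (`IsExtremal`). Both letters are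
repeated (`IsExtremal.one_le_left`), since otherwise the word could be shortened or `u` and `v` would
differ by the involution, and it follows that `2u + v` and `u + 2v` lie at the same distances from
and to `0` (`IsExtremal.false`). Hence `S` consists of one letter or of a block, possibly together
with an involution, and the four families result (`IsThin.isIsomorphic_of_isThin`).

Conversely, the word lengths in the four families are explicit (`IsLength`) and visibly separate the
elements.
-/

/-! ### Word length in Cayley digraphs -/

namespace Digraph

section WordLength

variable {A : Type*} [AddGroup A] {S : Set A}

/-- `g` is the sum of a word of exactly `n` letters from `S`. -/
def IsWordSum (S : Set A) (n : ℕ) (g : A) : Prop :=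
  ∃ l : List A, l.length = n ∧ (∀ x ∈ l, x ∈ S) ∧ l.sum = g

/-- The least number of letters from `S` in a word with sum `g` (inverses of letters are not
allowed); the value is `0` if there is no such word. -/
noncomputable def wordLength (S : Set A) (g : A) : ℕ := sInf {n | IsWordSum S n g}

/-- `S` is a set of nonzero elements whose words reach every group element, and `g` is determined
by the pair of the word lengths of `g` and `-g`. -/
structure IsThin (S : Set A) : Prop where
  zero_notMem : (0 : A) ∉ S
  generates : ∀ g, ∃ n, IsWordSum S n g
  eq_of_wordLength : ∀ g h, wordLength S g = wordLength S h →
    wordLength S (-g) = wordLength S (-h) → g = h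

theorem IsWordSum.zero : IsWordSum S 0 0 := ⟨[], rfl, by simp, rfl⟩

theorem isWordSum_zero_iff {g : A} : IsWordSum S 0 g ↔ g = 0 := by
  constructor
  · rintro ⟨l, hl, -, rfl⟩
    simp [List.length_eq_zero_iff.mp hl]
  · rintro rfl; exact .zero

theorem IsWordSum.single {x : A} (hx : x ∈ S) : IsWordSum S 1 x :=
  ⟨[x], rfl, by simpa using hx, by simp⟩

theorem IsWordSum.add {m n : ℕ} {g h : A} (hg : IsWordSum S m g) (hh : IsWordSum S n h) :
    IsWordSum S (m + n) (g + h) := by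
  obtain ⟨l, rfl, hl, rfl⟩ := hg
  obtain ⟨l', rfl, hl', rfl⟩ := hh
  refine ⟨l ++ l', by simp, ?_, by simp⟩
  intro x hx
  rcases List.mem_append.mp hx with h | h
  exacts [hl x h, hl' x h]

theorem IsWordSum.nsmul {x : A} (hx : x ∈ S) (n : ℕ) : IsWordSum S n (n • x) :=
  ⟨List.replicate n x, by simp, fun y hy => (List.eq_of_mem_replicate hy) ▸ hx, by simp⟩

theorem isWordSum_succ {n : ℕ} {g : A} :
    IsWordSum S (n + 1) g ↔ ∃ x ∈ S, ∃ h, IsWordSum S n h ∧ g = x + h := by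
  constructor
  · rintro ⟨l, hl, hS, rfl⟩
    obtain ⟨x, l', rfl⟩ := List.exists_cons_of_length_eq_add_one hl
    exact ⟨x, hS x (by simp), l'.sum, ⟨l', by simpa using hl, fun y hy => hS y (by simp [hy]), rfl⟩,
      by simp⟩
  · rintro ⟨x, hx, h, hh, rfl⟩
    rw [add_comm n 1]
    exact (IsWordSum.single hx).add hh

theorem isWordSum_succ' {n : ℕ} {g : A} :
    IsWordSum S (n + 1) g ↔ ∃ h, IsWordSum S n h ∧ -h + g ∈ S := by
  constructor
  · rintro ⟨l, hl, hS, rfl⟩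
    have hne : l ≠ [] := by rintro rfl; simp at hl
    refine ⟨l.dropLast.sum, ⟨l.dropLast, by simp [hl], fun y hy => hS y (List.mem_of_mem_dropLast hy),
      rfl⟩, ?_⟩
    have : l.dropLast.sum + l.getLast hne = l.sum := by
      conv_rhs => rw [← List.dropLast_append_getLast hne]
      simp
    rw [← this, neg_add_cancel_left]
    exact hS _ (List.getLast_mem hne)
  · rintro ⟨h, hh, hx⟩
    have := hh.add (IsWordSum.single hx)
    rwa [add_neg_cancel_left] at this

theorem isWordSum_one_iff {g : A} : IsWordSum S 1 g ↔ g ∈ S := by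
  rw [show 1 = 0 + 1 from rfl, isWordSum_succ]
  constructor
  · rintro ⟨x, hx, h, hh, rfl⟩
    rw [isWordSum_zero_iff] at hh
    simpa [hh] using hx
  · intro h
    exact ⟨g, h, 0, .zero, by simp⟩

theorem wordLength_le {n : ℕ} {g : A} (h : IsWordSum S n g) : wordLength S g ≤ n :=
  Nat.sInf_le h

/-- A function which is subadditive and at most `1` on letters bounds the word length from below. -/
theorem le_of_isWordSum {f : A → ℕ} (h0 : f 0 = 0) (hadd : ∀ g h, f (g + h) ≤ f g + f h)
    (hS : ∀ s ∈ S, f s ≤ 1) {n : ℕ} {g : A} (h : IsWordSum S n g) : f g ≤ n := by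
  induction n generalizing g with
  | zero => rw [isWordSum_zero_iff.mp h, h0]
  | succ n ih =>
    obtain ⟨x, hx, h', hh', rfl⟩ := isWordSum_succ.mp h
    have := ih hh'
    have := hadd x h'
    have := hS x hx
    omega

theorem wordLength_eq {f : A → ℕ} (h0 : f 0 = 0) (hadd : ∀ g h, f (g + h) ≤ f g + f h)
    (hS : ∀ s ∈ S, f s ≤ 1) (hf : ∀ g, IsWordSum S (f g) g) (g : A) : wordLength S g = f g :=
  le_antisymm (wordLength_le (hf g)) (le_of_isWordSum h0 hadd hS 
    (Nat.sInf_mem (s := {n | IsWordSum S n g}) ⟨_, hf g⟩))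

namespace IsThin

variable (hS : IsThin S)
include hS

theorem isWordSum (g : A) : IsWordSum S (wordLength S g) g := Nat.sInf_mem (hS.generates g)

theorem wordLength_eq_zero {g : A} (h : wordLength S g = 0) : g = 0 := by
  have := hS.isWordSum g
  rwa [h, isWordSum_zero_iff] at this

theorem mem_of_wordLength {g : A} (h : wordLength S g = 1) : g ∈ S := by
  have := hS.isWordSum g
  rwa [h, isWordSum_one_iff] at this

theorem wordLength_of_mem {g : A} (h : g ∈ S) : wordLength S g = 1 := by
  have h1 := wordLength_le (IsWordSum.single h)
  have h2 : wordLength S g ≠ 0 := fun h0 => hS.zero_notMem (hS.wordLength_eq_zero h0 ▸ h)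
  omega

theorem eq_of_mem {x y : A} (hx : x ∈ S) (hy : y ∈ S)
    (h : wordLength S (-x) = wordLength S (-y)) : x = y :=
  hS.eq_of_wordLength _ _ (by rw [hS.wordLength_of_mem hx, hS.wordLength_of_mem hy]) h

theorem eq_neg_self {g : A} (h : wordLength S g = wordLength S (-g)) : g = -g :=
  hS.eq_of_wordLength _ _ h (by rw [neg_neg, h])

end IsThin

end WordLength

end Digraph

/-! ### Commutativity -/

namespace Digraph

section Commutativity

variable {A : Type*} [AddGroup A] {S : Set A}

/-- A lower bound `t` for the number of letters that complete a product of two noncommuting letters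
to a closed word. -/
def IsNoncommBound (S : Set A) (t : ℕ) : Prop :=
  ∀ x ∈ S, ∀ y ∈ S, ¬ AddCommute x y → t ≤ wordLength S (-(x + y))

theorem neg_add_eq_of_add_add_eq_zero {u g w : A} (h : u + g + w = 0) : -g = w + u := by
  have h1 : u + (g + w) = 0 := by rw [← add_assoc, h]
  have h2 : u = -(g + w) := eq_neg_of_add_eq_zero_left h1
  rw [h2, neg_add_rev, add_neg_cancel_left]

namespace IsNoncommBound

variable {t : ℕ}

theorem le_of_isWordSum (ht : IsNoncommBound S t) {x y u w : A} {p q : ℕ} (hx : x ∈ S) (hy : y ∈ S)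
    (hxy : ¬ AddCommute x y) (hu : IsWordSum S p u) (hw : IsWordSum S q w)
    (h : u + (x + y) + w = 0) : t ≤ p + q := by
  refine (ht x hx y hy hxy).trans ?_
  rw [neg_add_eq_of_add_add_eq_zero h, add_comm p q]
  exact wordLength_le (hw.add hu)

theorem wordLength_eq (ht : IsNoncommBound S t) {x y u w : A} {p q : ℕ} (hx : x ∈ S) (hy : y ∈ S)
    (hxy : ¬ AddCommute x y) (hu : IsWordSum S p u) (hw : IsWordSum S q w)
    (h : u + (x + y) + w = 0) (hpq : p + q ≤ t) : wordLength S (-(x + y)) = t := by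
  refine le_antisymm ?_ (ht x hx y hy hxy)
  rw [neg_add_eq_of_add_add_eq_zero h]
  exact (wordLength_le (hw.add hu)).trans (by omega)

/-- In a closed word with at most `t + 1` letters, a letter commutes with all letters after it: it
can be moved past them one at a time. -/
theorem addCommute_of_mem (ht : IsNoncommBound S t) {d : A} (hd : d ∈ S) :
    ∀ (v : List A) (p : ℕ) (u : A), (∀ z ∈ v, z ∈ S) → IsWordSum S p u →
      u + d + v.sum = 0 → p + v.length ≤ t → ∀ z ∈ v, AddCommute d z := by
  intro v
  induction v with
  | nil => intro p u _ _ _ _ z hz; simp at hz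
  | cons z v ih =>
    intro p u hv hu h hp
    have hvS : ∀ y ∈ v, y ∈ S := fun y hy => hv y (by simp [hy])
    have hz : z ∈ S := hv z (by simp)
    rw [List.sum_cons] at h
    rw [List.length_cons] at hp
    have hdz : AddCommute d z := by
      by_contra hc
      have := ht.le_of_isWordSum hd hz hc hu (w := v.sum) ⟨v, rfl, hvS, rfl⟩
        (by rw [← h]; simp only [add_assoc])
      omega
    have := ih (p + 1) (u + z) hvS (hu.add (.single hz))
      (by rw [← h, add_assoc u z d, ← hdz.eq]; simp only [add_assoc]) (by omega)
    intro y hy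
    rcases List.mem_cons.mp hy with rfl | hy
    exacts [hdz, this y hy]

end IsNoncommBound

namespace IsThin

variable (hS : IsThin S)
include hS

theorem wordLength_add_of_not_addCommute {x y : A} (hx : x ∈ S) (hy : y ∈ S)
    (hxy : ¬ AddCommute x y) : wordLength S (x + y) = 1 ∨ wordLength S (x + y) = 2 := by
  have h1 := wordLength_le ((IsWordSum.single hx).add (.single hy))
  have h2 : wordLength S (x + y) ≠ 0 := fun h0 => hxy <| by
    rw [eq_neg_of_add_eq_zero_left (hS.wordLength_eq_zero h0)]
    exact (AddCommute.refl y).neg_left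
  omega

theorem add_eq_add_of_notMem {x y x' y' : A} (hx : x ∈ S) (hy : y ∈ S) (hx' : x' ∈ S)
    (hy' : y' ∈ S) (hxy : ¬ AddCommute x y) (hxy' : ¬ AddCommute x' y') (h : x + y ∉ S)
    (h' : x' + y' ∉ S) (ht : wordLength S (-(x + y)) = wordLength S (-(x' + y'))) :
    x + y = x' + y' := by
  refine hS.eq_of_wordLength _ _ ?_ ht
  rcases hS.wordLength_add_of_not_addCommute hx hy hxy with h1 | h1
  · exact absurd (hS.mem_of_wordLength h1) h
  rcases hS.wordLength_add_of_not_addCommute hx' hy' hxy' with h2 | h2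
  · exact absurd (hS.mem_of_wordLength h2) h'
  rw [h1, h2]

/-- The sum `d` of a noncommuting pair at the extremal distance `t` is not a letter. Otherwise `d`
closes up with `t` letters that commute with `d` and with each other; one of them, `c`, commutes
with neither `x` nor `y`, and both `y + c` and `c + x` are sums at distance `t`. -/
theorem add_notMem_of_not_addCommute {t : ℕ} (ht : IsNoncommBound S t) {x y : A} (hx : x ∈ S)
    (hy : y ∈ S) (hxy : ¬ AddCommute x y) (hxyt : wordLength S (-(x + y)) = t) : x + y ∉ S := by
  intro hd
  obtain ⟨v, hvl, hvS, hvs⟩ := hS.isWordSum (-(x + y))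
  rw [hxyt] at hvl
  have hdv : ∀ z ∈ v, AddCommute (x + y) z :=
    ht.addCommute_of_mem hd v 0 0 hvS .zero (by simp [hvs]) (by omega)
  obtain ⟨c, hcv, hyc⟩ : ∃ c ∈ v, ¬ AddCommute y c := by
    by_contra! hcon
    have h1 : AddCommute y v.sum := AddCommute.list_sum_right _ _ hcon
    rw [hvs] at h1
    have h2 : AddCommute y (x + y) := by simpa using h1.neg_right
    apply hxy
    have h3 := h2.eq
    rw [← add_assoc] at h3
    exact (add_right_cancel h3).symm
  have hc : c ∈ S := hvS c hcv
  obtain ⟨l₁, l₂, rfl⟩ := List.append_of_mem hcv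
  have hl₁ : ∀ z ∈ l₁, z ∈ S := fun z hz => hvS z (by simp [hz])
  have hl₂ : ∀ z ∈ l₂, z ∈ S := fun z hz => hvS z (by simp [hz])
  simp only [List.length_append, List.length_cons] at hvl
  simp only [List.sum_append, List.sum_cons] at hvs
  have hcl : ∀ z ∈ l₂ ++ (x + y) :: l₁, AddCommute c z := by
    refine ht.addCommute_of_mem hc _ 0 0 ?_ .zero ?_ ?_
    · intro z hz
      simp only [List.mem_append, List.mem_cons] at hz
      rcases hz with hz | rfl | hz
      exacts [hl₂ z hz, hd, hl₁ z hz]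
    · simp only [List.sum_append, List.sum_cons, zero_add]
      have h1 : x + y = -(l₁.sum + (c + l₂.sum)) := by rw [hvs, neg_neg]
      rw [h1]
      simp [add_assoc]
    · simp only [List.length_append, List.length_cons]; omega
  have hc1 : c + l₁.sum = l₁.sum + c :=
    (AddCommute.list_sum_right _ _ fun z hz => hcl z (by simp [hz])).eq
  have hc2 : c + l₂.sum = l₂.sum + c :=
    (AddCommute.list_sum_right _ _ fun z hz => hcl z (by simp [hz])).eq
  have hcd : AddCommute c (x + y) := hcl _ (by simp)
  have hR : IsWordSum S (l₁.length + l₂.length) (l₁.sum + l₂.sum) :=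
    IsWordSum.add ⟨l₁, rfl, hl₁, rfl⟩ ⟨l₂, rfl, hl₂, rfl⟩
  set R := l₁.sum + l₂.sum with hRdef
  have e1 : x + y + (c + R) = 0 := by
    rw [hRdef, ← add_assoc c, hc1, add_assoc l₁.sum, hvs, add_neg_cancel]
  have e2 : c + R = R + c := by
    rw [hRdef, ← add_assoc, hc1, add_assoc, hc2, add_assoc]
  have hcx : ¬ AddCommute c x := fun h => hyc <| by
    have h3 := hcd.eq
    rw [← add_assoc, h.eq, add_assoc, add_assoc] at h3
    exact (add_left_cancel h3).symm
  have t1 : wordLength S (-(y + c)) = t :=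
    ht.wordLength_eq hy hc hyc (.single hx) hR (by rw [← e1]; simp only [add_assoc]) (by omega)
  have t2 : wordLength S (-(c + x)) = t := by
    refine ht.wordLength_eq hc hx hcx .zero ((IsWordSum.single hy).add hR) ?_ (by omega)
    rw [zero_add, add_assoc, ← add_assoc x, ← add_assoc, hcd.eq, add_assoc, e1]
  have n1 : y + c ∉ S := fun h => hyc <| by
    have h1 : y + c = x + y := hS.eq_of_mem h hd (by rw [t1, hxyt])
    have h2 : y = x + y + -c := by rw [← h1, add_neg_cancel_right]
    have h3 : AddCommute (x + y + -c) c :=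
      hcd.symm.add_left (AddCommute.refl c).neg_left
    rwa [← h2] at h3
  have n2 : c + x ∉ S := fun h => hcx <| by
    have h1 : c + x = x + y := hS.eq_of_mem h hd (by rw [t2, hxyt])
    have h2 : x = -c + (x + y) := by rw [← h1, neg_add_cancel_left]
    have h3 : AddCommute c (-c + (x + y)) :=
      ((AddCommute.refl c).neg_right).add_right hcd
    rwa [← h2] at h3
  have e3 : y + c = c + x := hS.add_eq_add_of_notMem hy hc hc hx hyc hcx n1 n2 (by rw [t1, t2])
  have hxc : ¬ AddCommute x c := fun h => hcx h.symm
  have t3 : wordLength S (-(x + c)) = t := by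
    refine ht.wordLength_eq hx hc hxc .zero ((IsWordSum.single hx).add hR) ?_ (by omega)
    rw [zero_add, add_assoc, ← add_assoc c, ← e3, ← e1]
    simp only [add_assoc]
  by_cases n3 : x + c ∈ S
  · have h1 : x + c = x + y := hS.eq_of_mem n3 hd (by rw [t3, hxyt])
    rw [add_left_cancel h1] at hyc
    exact hyc (.refl y)
  · have h1 := hS.add_eq_add_of_notMem hx hc hy hc hxc hyc n3 n1 (by rw [t3, t1])
    rw [add_right_cancel h1] at hxy
    exact hxy (.refl y)

/-- No closed word of length `t + 2` has the form `ζ + x + (m + 1) • y + ρ` with noncommuting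
letters `x`, `y` and with `ζ` a sum of letters commuting with both. All noncommuting neighbours in
such a word have the same sum, so that each letter of `ρ` can be absorbed in turn. -/
theorem not_closed_of_not_addCommute {t : ℕ} (ht : IsNoncommBound S t) (r : List A) :
    ∀ (x y ζ : A) (m p : ℕ), x ∈ S → y ∈ S → ¬ AddCommute x y → IsWordSum S p ζ →
      AddCommute ζ x → AddCommute ζ y → (∀ z ∈ r, z ∈ S) → p + m + r.length ≤ t →
      ζ + x + (m + 1) • y + r.sum ≠ 0 := by
  induction r with
  | nil =>
    intro x y ζ m p hx hy hxy hζ hζx hζy _ hp h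
    apply hxy
    rw [List.sum_nil, add_zero, add_assoc] at h
    have h1 : x = -ζ + -((m + 1) • y) := by
      have h2 : x + (m + 1) • y = -ζ := (neg_eq_of_add_eq_zero_right h).symm
      rw [← h2, add_neg_cancel_right]
    rw [h1]
    exact hζy.neg_left.add_left (((AddCommute.refl y).nsmul_left _).neg_left)
  | cons z r ih =>
    intro x y ζ m p hx hy hxy hζ hζx hζy hr hp h
    have hz : z ∈ S := hr z (by simp)
    have hr' : ∀ z ∈ r, z ∈ S := fun z hz => hr z (by simp [hz])
    have hρ : IsWordSum S r.length r.sum := ⟨r, rfl, hr', rfl⟩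
    rw [List.length_cons] at hp
    rw [List.sum_cons] at h
    -- all noncommuting neighbours have the sum `x + y`
    have key : ∀ x' y' u w : A, ∀ a b : ℕ, x' ∈ S → y' ∈ S → ¬ AddCommute x' y' →
        IsWordSum S a u → IsWordSum S b w → u + (x' + y') + w = 0 → a + b ≤ t →
        x' + y' = x + y := by
      intro x' y' u w a b hx' hy' hc hu hw h0 hab
      have l1 := ht.wordLength_eq hx' hy' hc hu hw h0 hab
      have l2 := ht.wordLength_eq hx hy hxy hζ
        (((IsWordSum.nsmul hy m).add (.single hz)).add hρ)
        (by rw [← h, succ_nsmul']; simp only [add_assoc]) (by omega)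
      exact hS.add_eq_add_of_notMem hx' hy' hx hy hc hxy
        (hS.add_notMem_of_not_addCommute ht hx' hy' hc l1)
        (hS.add_notMem_of_not_addCommute ht hx hy hxy l2) (by rw [l1, l2])
    by_cases hyz : AddCommute y z
    · have hyz' : (m + 1) • y + z = z + (m + 1) • y := (hyz.nsmul_left _).eq
      have h' : ζ + (x + z) + ((m + 1) • y + r.sum) = 0 := by
        rw [← h, add_assoc (ζ + x), ← add_assoc _ z, hyz']
        simp only [add_assoc]
      by_cases hxz : AddCommute x z
      · refine ih x y (ζ + z) m (p + 1) hx hy hxy (hζ.add (.single hz))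
          (hζx.add_left hxz.symm) (hζy.add_left hyz.symm) hr' (by omega) ?_
        rw [← h', hxz.eq]
        simp only [add_assoc]
      · have hzy := key x z ζ _ p _ hx hz hxz hζ ((IsWordSum.nsmul hy (m + 1)).add hρ) h' (by omega)
        have hzy : z = y := add_left_cancel hzy
        subst hzy
        refine ih x z ζ (m + 1) p hx hy hxy hζ hζx hζy hr' (by omega) ?_
        rw [← h, succ_nsmul _ (m + 1)]
        simp only [add_assoc]
    · have hg : y + z = x + y := by
        refine key y z (ζ + x + m • y) r.sum (p + 1 + m) _ hy hz hyz
          ((hζ.add (.single hx)).add (.nsmul hy m)) hρ ?_ (by omega)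
        rw [← h, succ_nsmul]
        simp only [add_assoc]
      rcases Nat.eq_zero_or_pos m with rfl | hm
      · have hζz : AddCommute ζ z := by
          have h1 : z = -y + (x + y) := by rw [← hg, neg_add_cancel_left]
          rw [h1]
          exact hζy.neg_right.add_right (hζx.add_right hζy)
        refine ih y z ζ 1 p hy hz hyz hζ hζy hζz hr' (by omega) ?_
        rw [← h, show (1 + 1 : ℕ) • z = z + z from two_nsmul z, zero_add, one_nsmul,
          add_assoc ζ x y, ← hg]
        simp only [add_assoc]
      · obtain ⟨m, rfl⟩ := Nat.exists_eq_succ_of_ne_zero hm.ne'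
        have hzy : ¬ AddCommute z y := fun h => hyz h.symm
        have h1 : z + y = x + y := by
          refine key z y (ζ + y) (m • y + z + r.sum) (p + 1) (m + 1 + r.length) hz hy hzy
            (hζ.add (.single hy)) (((IsWordSum.nsmul hy m).add (.single hz)).add hρ) ?_ (by omega)
          rw [← h, Nat.succ_eq_add_one, succ_nsmul', succ_nsmul', ← add_assoc _ y (y + m • y),
            add_assoc ζ x y, ← hg]
          simp only [add_assoc]
        exact hyz (hg.trans h1.symm)

theorem addCommute_of_mem {x y : A} (hx : x ∈ S) (hy : y ∈ S) : AddCommute x y := by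
  classical
  by_contra hxy
  have hex : ∃ t, ∃ x ∈ S, ∃ y ∈ S, ¬ AddCommute x y ∧ wordLength S (-(x + y)) = t :=
    ⟨_, x, hx, y, hy, hxy, rfl⟩
  have ht : IsNoncommBound S (Nat.find hex) := fun x hx y hy hxy =>
    Nat.find_min' hex ⟨x, hx, y, hy, hxy, rfl⟩
  obtain ⟨x, hx, y, hy, hxy, h⟩ := Nat.find_spec hex
  obtain ⟨r, hrl, hrS, hrs⟩ := hS.isWordSum (-(x + y))
  refine hS.not_closed_of_not_addCommute ht r x y 0 0 0 hx hy hxy .zero (.zero_left x)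
    (.zero_left y) hrS (by omega) ?_
  rw [hrs]
  simp

theorem add_comm_of_isThin (g h : A) : g + h = h + g := by
  obtain ⟨l, -, hl, rfl⟩ := hS.isWordSum g
  obtain ⟨l', -, hl', rfl⟩ := hS.isWordSum h
  exact (AddCommute.list_sum_left _ _ fun x hx => AddCommute.list_sum_right _ _ fun y hy =>
    hS.addCommute_of_mem (hl x hx) (hl' y hy)).eq

end IsThin

end Commutativity

end Digraph

/-! ### Blocks and far pairs -/

namespace Digraph

section Blocks

variable {A : Type*} [AddCommGroup A] {S : Set A}

/-- The least number of letters from `S` that complete `g` to a closed word, that is, the distance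
from `g` to `0` in the Cayley digraph. -/
noncomputable def backLength (S : Set A) (g : A) : ℕ := wordLength S (-g)

/-- A letter that is not an involution. -/
def IsRegular (S : Set A) (x : A) : Prop := x ∈ S ∧ x + x ≠ 0

/-- A letter that is an involution. -/
def IsInvolution (S : Set A) (x : A) : Prop := x ∈ S ∧ x + x = 0

/-- A word with at most one letter, that letter being an involution: either `ε = 0` and `f = 0`, or
`ε = 1` and `f` is an involution in `S`. -/
def IsTail (S : Set A) (ε : ℕ) (f : A) : Prop := ε = 0 ∧ f = 0 ∨ ε = 1 ∧ IsInvolution S f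

/-- The letters `a` and `b = 2a` behave like `1` and `2` in `Cay(ℤ₂ₙ, {1, 2})`, where `n ≥ 3`:
`b` has order `n = backLength S b + 1`, and `backLength S a = n`. -/
structure IsBlock (S : Set A) (a b : A) : Prop where
  left : IsRegular S a
  right : IsRegular S b
  double : a + a = b
  order : (backLength S b + 1) • b = 0
  back : backLength S a = backLength S b + 1

/-- Distinct letters, neither of them an involution, that do not form a block. -/
structure IsFar (S : Set A) (u v : A) : Prop where
  left : IsRegular S u
  right : IsRegular S v
  ne : u ≠ v
  not_block : ¬ IsBlock S u v
  not_block' : ¬ IsBlock S v u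

/-- At least `T` letters are needed to close up `u + v`, for each far pair `u`, `v`. -/
def IsFarBound (S : Set A) (T : ℕ) : Prop := ∀ u v, IsFar S u v → T ≤ backLength S (u + v)

theorem backLength_le {n : ℕ} {g w : A} (h : IsWordSum S n w) (hg : g + w = 0) :
    backLength S g ≤ n := by
  rw [backLength, neg_eq_of_add_eq_zero_right hg]
  exact wordLength_le h

theorem IsTail.isWordSum {ε : ℕ} {f : A} (h : IsTail S ε f) : IsWordSum S ε f := by
  rcases h with ⟨rfl, rfl⟩ | ⟨rfl, h⟩
  exacts [.zero, .single h.1]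

theorem IsTail.zero : IsTail S 0 (0 : A) := .inl ⟨rfl, rfl⟩

theorem IsInvolution.tail {e : A} (h : IsInvolution S e) : IsTail S 1 e := .inr ⟨rfl, h⟩

theorem IsTail.add_self {ε : ℕ} {f : A} (h : IsTail S ε f) : f + f = 0 := by
  rcases h with ⟨rfl, rfl⟩ | ⟨rfl, h⟩
  exacts [add_zero 0, h.2]

theorem IsTail.le_one {ε : ℕ} {f : A} (h : IsTail S ε f) : ε ≤ 1 := by
  rcases h with ⟨rfl, -⟩ | ⟨rfl, -⟩ <;> omega

theorem IsFar.symm {u v : A} (h : IsFar S u v) : IsFar S v u :=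
  ⟨h.right, h.left, h.ne.symm, h.not_block', h.not_block⟩

theorem IsFarBound.le {T n : ℕ} (hT : IsFarBound S T) {u v w : A} (huv : IsFar S u v)
    (hw : IsWordSum S n w) (h : u + v + w = 0) : T ≤ n :=
  (hT u v huv).trans (backLength_le hw h)

theorem IsFarBound.backLength_eq {T n : ℕ} (hT : IsFarBound S T) {u v w : A} (huv : IsFar S u v)
    (hw : IsWordSum S n w) (h : u + v + w = 0) (hn : n ≤ T) : backLength S (u + v) = T :=
  le_antisymm ((backLength_le hw h).trans hn) (hT u v huv)

theorem IsRegular.ne_of_isInvolution {x e : A} (hx : IsRegular S x) (he : IsInvolution S e) :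
    x ≠ e := by
  rintro rfl; exact hx.2 he.2

theorem isRegular_or_isInvolution {x : A} (hx : x ∈ S) : IsRegular S x ∨ IsInvolution S x := by
  by_cases h : x + x = 0
  exacts [.inr ⟨hx, h⟩, .inl ⟨hx, h⟩]

theorem eq_or_block_or_far {u c : A} (hu : IsRegular S u) (hc : IsRegular S c) :
    c = u ∨ IsBlock S u c ∨ IsBlock S c u ∨ IsFar S u c := by
  by_cases h1 : c = u
  · exact .inl h1
  by_cases h2 : IsBlock S u c
  · exact .inr (.inl h2)
  by_cases h3 : IsBlock S c u
  · exact .inr (.inr (.inl h3))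
  exact .inr (.inr (.inr ⟨hu, hc, fun h => h1 h.symm, h2, h3⟩))

theorem IsBlock.ne {a b : A} (h : IsBlock S a b) : a ≠ b := fun hab =>
  h.left.2 (by have := h.double; rw [← hab] at this; rw [left_eq_add.mp this.symm, add_zero])

theorem IsBlock.right_unique {a b c : A} (h : IsBlock S a b) (h' : IsBlock S a c) : b = c :=
  h.double.symm.trans h'.double

theorem IsBlock.not_chain {a b c : A} (h : IsBlock S a b) (h' : IsBlock S b c) : False := by
  refine h.right.2 ?_
  have h1 := h.order
  have h2 := h'.order
  rw [h'.back] at h1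
  linear_combination (norm := module)
    2 • h1 - h2 - ((backLength S c : ℤ) + 1) • h'.double

namespace IsThin

variable (hS : IsThin S)
include hS

theorem isWordSum_backLength (g : A) : IsWordSum S (backLength S g) (-g) := hS.isWordSum (-g)

theorem backLength_le_succ {x : A} (hx : x ∈ S) (g : A) :
    backLength S g ≤ backLength S (x + g) + 1 :=
  backLength_le ((hS.isWordSum_backLength (x + g)).add (.single hx)) (by abel)

theorem backLength_involution {e : A} (he : IsInvolution S e) : backLength S e = 1 := by
  rw [backLength, neg_eq_of_add_eq_zero_right he.2]
  exact hS.wordLength_of_mem he.1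

theorem eq_of_backLength {x y : A} (hx : x ∈ S) (hy : y ∈ S)
    (h : backLength S x = backLength S y) : x = y := hS.eq_of_mem hx hy h

theorem involution_unique {e e' : A} (he : IsInvolution S e) (he' : IsInvolution S e') : e = e' :=
  hS.eq_of_backLength he.1 he'.1 (by rw [hS.backLength_involution he, hS.backLength_involution he'])

theorem ne_zero_of_mem {x : A} (hx : x ∈ S) : x ≠ 0 := fun h => hS.zero_notMem (h ▸ hx)

theorem two_le_backLength {x : A} (hx : IsRegular S x) : 2 ≤ backLength S x := by
  by_contra! h
  have h0 : backLength S x ≠ 0 := fun h0 =>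
    hS.ne_zero_of_mem hx.1 (neg_eq_zero.mp (hS.wordLength_eq_zero h0))
  have h1 : wordLength S x = wordLength S (-x) := by
    rw [hS.wordLength_of_mem hx.1]
    change 1 = backLength S x
    omega
  have h2 := hS.eq_neg_self h1
  exact hx.2 (by nth_rw 2 [h2]; exact add_neg_cancel x)

theorem add_ne_zero_of_mem {x y : A} (hx : IsRegular S x) (hy : y ∈ S) : x + y ≠ 0 := fun h => by
  have := backLength_le (.single hy) h
  have := hS.two_le_backLength hx
  omega

/-- Two distinct letters that are not involutions do not add up to an involution in `S`: both would
have back length `2`. -/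
theorem eq_of_add_isInvolution {u c : A} (hu : IsRegular S u) (hc : IsRegular S c)
    (h : IsInvolution S (u + c)) : u = c := by
  have h1 : backLength S u ≤ 2 := backLength_le ((IsWordSum.single hc.1).add (.single h.1))
    (by rw [← add_assoc]; exact h.2)
  have h2 : backLength S c ≤ 2 := backLength_le ((IsWordSum.single hu.1).add (.single h.1))
    (by rw [← add_assoc, add_comm c u]; exact h.2)
  have h3 := hS.two_le_backLength hu
  have h4 := hS.two_le_backLength hc
  exact hS.eq_of_backLength hu.1 hc.1 (by omega)

theorem add_tail_ne_zero {u v f : A} {ε : ℕ} (hu : IsRegular S u) (hv : IsRegular S v) (huv : u ≠ v)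
    (hf : IsTail S ε f) : u + v + f ≠ 0 := fun h => by
  rcases hf with ⟨-, rfl⟩ | ⟨-, hf⟩
  · exact hS.add_ne_zero_of_mem hu hv.1 (by simpa using h)
  · refine huv (hS.eq_of_add_isInvolution hu hv ?_)
    have h1 : u + v = f := by linear_combination (norm := module) h - hf.2
    rwa [h1]

theorem tail_ne {u f : A} {ε : ℕ} (hu : IsRegular S u) (hf : IsTail S ε f) : u ≠ f := by
  rcases hf with ⟨-, rfl⟩ | ⟨-, hf⟩
  · exact hS.ne_zero_of_mem hu.1
  · exact hu.ne_of_isInvolution hf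

theorem tail_add {f f' : A} {ε ε' : ℕ} (hf : IsTail S ε f) (hf' : IsTail S ε' f') :
    ∃ δ, δ ≤ ε + ε' ∧ IsTail S δ (f + f') := by
  rcases hf with ⟨rfl, rfl⟩ | ⟨rfl, hf⟩
  · exact ⟨ε', by omega, by rwa [zero_add]⟩
  rcases hf' with ⟨rfl, rfl⟩ | ⟨rfl, hf'⟩
  · exact ⟨1, by omega, by rw [add_zero]; exact hf.tail⟩
  · exact ⟨0, by omega, by rw [hS.involution_unique hf' hf, hf.2]; exact .zero⟩

theorem block_left_unique {a a' b : A} (h : IsBlock S a b) (h' : IsBlock S a' b) : a = a' :=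
  hS.eq_of_backLength h.left.1 h'.left.1 (by rw [h.back, h'.back])

theorem far_of_block {u v c : A} (h : IsBlock S u c ∨ IsBlock S c u) (huv : IsFar S u v) :
    IsFar S c v := by
  rcases h with h | h
  · refine ⟨h.right, huv.right, ?_, fun h' => h.not_chain h', fun h' => ?_⟩
    · rintro rfl; exact huv.not_block h
    · exact huv.ne (hS.block_left_unique h h')
  · refine ⟨h.left, huv.right, ?_, fun h' => huv.ne (h.right_unique h'), fun h' => ?_⟩
    · rintro rfl; exact huv.not_block' h
    · exact IsBlock.not_chain h' h

theorem wordLength_add {x y : A} (hx : IsRegular S x) (hy : y ∈ S) :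
    wordLength S (x + y) = 1 ∨ wordLength S (x + y) = 2 := by
  have h1 := wordLength_le ((IsWordSum.single hx.1).add (.single hy))
  have h2 : wordLength S (x + y) ≠ 0 := fun h0 =>
    hS.add_ne_zero_of_mem hx hy (hS.wordLength_eq_zero h0)
  omega

theorem eq_of_wordLength_backLength {g h : A} (h1 : wordLength S g = wordLength S h)
    (h2 : backLength S g = backLength S h) : g = h := hS.eq_of_wordLength g h h1 h2

variable {T : ℕ} (hT : IsFarBound S T)
include hT

/-- A word closing up a far pair `u`, `v` does not contain `u` if `2u` completes `u` to a block: two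
letters `u` could be replaced by one letter `2u`. -/
theorem le_of_block_left {u v c w : A} {n : ℕ} (huv : IsFar S u v) (hc : IsBlock S u c)
    (hw : IsWordSum S n w) (h : u + v + (u + w) = 0) : T ≤ n :=
  hT.le (hS.far_of_block (.inl hc) huv) hw (by rw [← hc.double, ← h]; abel)

theorem le_of_add_mem_of_block {p q v w : A} {n : ℕ} (hpv : IsFar S p v)
    (hpq : IsBlock S p q ∨ IsBlock S q p) (hd : p + v ∈ S) (hw : IsWordSum S n w)
    (h : p + v + q + w = 0) : T ≤ n := by
  have hq : IsRegular S q := hpq.elim (·.right) (·.left)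
  have hdp : p + v ≠ p := fun h => hS.ne_zero_of_mem hpv.right.1 (by simpa using h)
  rcases isRegular_or_isInvolution hd with hd | hd
  · rcases eq_or_block_or_far hd hq with h1 | h1 | h1 | h1
    · exfalso
      rcases hpq with hpq | hpq
      · exact hpv.ne (add_left_cancel (hpq.double.trans h1))
      · have h2 : q + v = 0 := by linear_combination (norm := module) hpq.double - h1
        exact hS.add_ne_zero_of_mem hq hpv.right.1 h2
    · rcases hpq with hpq | hpq
      · exact absurd (hS.block_left_unique h1 hpq) hdp
      · exact (h1.not_chain hpq).elim
    · rcases hpq with hpq | hpq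
      · exact (hpq.not_chain h1).elim
      · exact absurd (h1.right_unique hpq) hdp
    · exact hT.le h1 hw h
  · exact absurd (hS.eq_of_add_isInvolution hpv.left hpv.right hd) hpv.ne

theorem le_of_block_of_far {p q v w : A} {n : ℕ} (hpv : IsFar S p v)
    (hpq : IsBlock S p q ∨ IsBlock S q p) (hw : IsWordSum S n w) (h : v + p + q + w = 0) :
    T ≤ n := by
  by_contra! hn
  have hqv : IsFar S q v := hS.far_of_block hpq hpv
  have h1 : backLength S (p + v) = T := hT.backLength_eq hpv
    ((IsWordSum.single hqv.left.1).add hw) (by rw [← h]; abel) (by omega)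
  have h2 : backLength S (q + v) = T := hT.backLength_eq hqv
    ((IsWordSum.single hpv.left.1).add hw) (by rw [← h]; abel) (by omega)
  rcases hS.wordLength_add hpv.left hpv.right.1 with l1 | l1
  · exact hn.not_ge (hS.le_of_add_mem_of_block hT hpv hpq (hS.mem_of_wordLength l1) hw
      (by rw [← h]; abel))
  rcases hS.wordLength_add hqv.left hpv.right.1 with l2 | l2
  · exact hn.not_ge (hS.le_of_add_mem_of_block hT hqv hpq.symm (hS.mem_of_wordLength l2) hw
      (by rw [← h]; abel))
  have h3 := add_right_cancel
    (hS.eq_of_wordLength_backLength (l1.trans l2.symm) (h1.trans h2.symm))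
  rcases hpq with hpq | hpq
  · exact hpq.ne h3
  · exact hpq.ne h3.symm

/-- A shortest closed word that contains a far pair `u`, `v` contains no further letter `c`, up to
involutions: the sums of the pairs among `u`, `v`, `c` would lie at the same distance `T` to `0` and
at distance `1` or `2` from `0`. -/
theorem le_of_third_letter {u v c w : A} {n : ℕ} (huv : IsFar S u v) (hc : IsRegular S c)
    (hcu : c ≠ u) (hcv : c ≠ v) (hw : IsWordSum S n w) (h : u + v + (c + w) = 0) : T ≤ n := by
  by_contra! hn
  have e1 : u + v + c + w = 0 := by rw [← h]; abel
  have e2 : v + u + c + w = 0 := by rw [← h]; abel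
  have far : ∀ {u v : A}, IsFar S u v → c ≠ u → u + v + c + w = 0 → v + u + c + w = 0 →
      IsFar S u c := by
    intro u v huv hcu e1 e2
    rcases eq_or_block_or_far huv.left hc with h1 | h1 | h1 | h1
    · exact absurd h1 hcu
    · exact absurd (hS.le_of_block_of_far hT huv (.inl h1) hw e2) hn.not_ge
    · exact absurd (hS.le_of_block_of_far hT huv (.inr h1) hw e2) hn.not_ge
    · exact h1
  have fu : IsFar S u c := far huv hcu e1 e2
  have fv : IsFar S v c := far huv.symm hcv e2 e1
  have b1 : backLength S (u + v) = T := hT.backLength_eq huv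
    ((IsWordSum.single hc.1).add hw) h (by omega)
  have b2 : backLength S (u + c) = T := hT.backLength_eq fu
    ((IsWordSum.single huv.right.1).add hw) (by rw [← h]; abel) (by omega)
  have b3 : backLength S (v + c) = T := hT.backLength_eq fv
    ((IsWordSum.single huv.left.1).add hw) (by rw [← h]; abel) (by omega)
  have d1 : wordLength S (u + v) ≠ wordLength S (u + c) := fun h0 => hcv <| Eq.symm <|
    add_left_cancel (hS.eq_of_wordLength_backLength h0 (b1.trans b2.symm))
  have d2 : wordLength S (u + v) ≠ wordLength S (v + c) := fun h0 => hcu <| Eq.symm <|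
    add_left_cancel ((add_comm v u).trans
      (hS.eq_of_wordLength_backLength h0 (b1.trans b3.symm)))
  have d3 : wordLength S (u + c) ≠ wordLength S (v + c) := fun h0 => huv.ne <|
    add_right_cancel (hS.eq_of_wordLength_backLength h0 (b2.trans b3.symm))
  have l1 := hS.wordLength_add huv.left huv.right.1
  have l2 := hS.wordLength_add fu.left hc.1
  have l3 := hS.wordLength_add fv.left hc.1
  omega

omit hT in
/-- A word in `u`, `v` and involutions, with pairs of involutions cancelled. -/
theorem exists_normalForm (u v : A) (l : List A)
    (hl : ∀ z ∈ l, z = u ∨ z = v ∨ IsInvolution S z) :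
    ∃ x y ε f, IsTail S ε f ∧ x • u + y • v + f = l.sum ∧ x + y + ε ≤ l.length := by
  induction l with
  | nil => exact ⟨0, 0, 0, 0, .zero, by simp, by simp⟩
  | cons z l ih =>
    obtain ⟨x, y, ε, f, hf, hs, hn⟩ := ih fun z hz => hl z (by simp [hz])
    rw [List.sum_cons, List.length_cons, ← hs]
    rcases hl z (by simp) with rfl | rfl | hz
    · exact ⟨x + 1, y, ε, f, hf, by module, by omega⟩
    · exact ⟨x, y + 1, ε, f, hf, by module, by omega⟩
    · obtain ⟨δ, hδ, hd⟩ := hS.tail_add hf hz.tail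
      exact ⟨x, y, δ, f + z, hd, by module, by omega⟩

end IsThin

/-- A shortest closed word containing a far pair `u`, `v`, in normal form: it consists of `x + 1`
letters `u`, `y + 1` letters `v` and possibly one involution. -/
structure IsExtremal (S : Set A) (T : ℕ) (u v : A) (x y ε : ℕ) (f : A) : Prop where
  bound : IsFarBound S T
  far : IsFar S u v
  tail : IsTail S ε f
  closed : (x + 1) • u + (y + 1) • v + f = 0
  card : x + y + ε = T

theorem IsExtremal.symm {T x y ε : ℕ} {u v f : A} (h : IsExtremal S T u v x y ε f) :
    IsExtremal S T v u y x ε f :=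
  ⟨h.bound, h.far.symm, h.tail, by rw [← h.closed]; abel, by rw [← h.card]; omega⟩

theorem IsThin.exists_isExtremal (hS : IsThin S) {T : ℕ} (hT : IsFarBound S T) {u v : A}
    (huv : IsFar S u v) (h : backLength S (u + v) = T) :
    ∃ x y ε f, IsExtremal S T u v x y ε f := by
  obtain ⟨l, hl, hlS, hls⟩ := hS.isWordSum_backLength (u + v)
  have hlet : ∀ z ∈ l, z = u ∨ z = v ∨ IsInvolution S z := by
    intro z hz
    rcases isRegular_or_isInvolution (hlS z hz) with hr | hi
    · by_contra! hcon
      obtain ⟨l₁, l₂, rfl⟩ := List.append_of_mem hz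
      have := hS.le_of_third_letter hT huv hr hcon.1 hcon.2.1 (w := (l₁ ++ l₂).sum)
        ⟨l₁ ++ l₂, rfl, fun z hz => hlS z (by
          simp only [List.mem_append, List.mem_cons] at hz ⊢; tauto), rfl⟩ (by
          have h0 : u + v + (l₁ ++ z :: l₂).sum = 0 := by rw [hls, add_neg_cancel]
          rw [← h0]
          simp only [List.sum_append, List.sum_cons]
          abel)
      simp only [List.length_append, List.length_cons] at hl this
      omega
    · exact .inr (.inr hi)
  obtain ⟨x, y, ε, f, hf, hs, hn⟩ := hS.exists_normalForm u v l hlet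
  have hc : u + v + (x • u + y • v + f) = 0 := by rw [hs, hls, add_neg_cancel]
  have := hT.le huv (((IsWordSum.nsmul huv.left.1 x).add (.nsmul huv.right.1 y)).add hf.isWordSum) hc
  exact ⟨x, y, ε, f, hT, huv, hf, by rw [← hc]; module, by omega⟩

end Blocks

end Digraph

/-! ### Nonexistence of far pairs -/

namespace Digraph

section Extremal

variable {A : Type*} [AddCommGroup A] {S : Set A} {T x y ε : ℕ} {u v f : A}

namespace IsExtremal

variable (h : IsExtremal S T u v x y ε f)
include h

theorem isWordSum (a b : ℕ) : IsWordSum S (a + b + ε) (a • u + b • v + f) :=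
  ((IsWordSum.nsmul h.far.left.1 a).add (.nsmul h.far.right.1 b)).add h.tail.isWordSum

theorem backLength_add : backLength S (u + v) = T := by
  refine h.bound.backLength_eq h.far (h.isWordSum x y) ?_ h.card.le
  rw [← h.closed]
  module

theorem not_isBlock (hS : IsThin S) (hx : 1 ≤ x) (c : A) : ¬ IsBlock S u c := fun hc => by
  obtain ⟨x, rfl⟩ := Nat.exists_eq_add_of_le' hx
  have := hS.le_of_block_left h.bound h.far hc (h.isWordSum x y) (by rw [← h.closed]; module)
  have := h.card
  omega

/-- The sum of the two letters is not itself a letter: as such it would make the closed word shorter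
while forming a far pair with a remaining letter. -/
theorem add_notMem (hS : IsThin S) : u + v ∉ S := by
  intro hd
  have key : ∀ {x y : ℕ} {u v : A}, IsExtremal S T u v x y ε f → IsRegular S (u + v) → ¬ 1 ≤ y := by
    intro x y u v h hd hy
    obtain ⟨y, rfl⟩ := Nat.exists_eq_add_of_le' hy
    rcases eq_or_block_or_far hd h.far.right with h1 | h1 | h1 | h1
    · exact hS.ne_zero_of_mem h.far.left.1 (by simpa using h1)
    · refine hS.add_ne_zero_of_mem hd h.far.left.1 ?_
      linear_combination (norm := module) h1.double
    · exact h.far.ne (add_right_cancel h1.double).symm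
    · have := h.bound.le h1 (h.isWordSum x y) (by rw [← h.closed]; module)
      have := h.card
      omega
  rcases isRegular_or_isInvolution hd with hd | hd
  · have hy := key h hd
    have hx := key h.symm (by rwa [add_comm])
    obtain rfl : x = 0 := by omega
    obtain rfl : y = 0 := by omega
    exact hS.add_tail_ne_zero h.far.left h.far.right h.far.ne h.tail (by simpa using h.closed)
  · exact h.far.ne (hS.eq_of_add_isInvolution h.far.left h.far.right hd)

theorem wordLength_add (hS : IsThin S) : wordLength S (u + v) = 2 := by
  rcases hS.wordLength_add h.far.left h.far.right.1 with h1 | h1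
  · exact absurd (hS.mem_of_wordLength h1) (h.add_notMem hS)
  · exact h1

end IsExtremal

/-- If `v` is not the first letter of a block and `T • v` is an involution in `S`, where
`T = backLength S v`, then `2v` and `v + T • v` lie at the same distances from and to `0`. -/
theorem IsThin.not_nsmul_isInvolution (hS : IsThin S) (hT : IsFarBound S T) (hv : IsRegular S v)
    (hk : backLength S v = T) (h3 : 3 ≤ T) (hb : ∀ c, ¬ IsBlock S v c) :
    ¬ IsInvolution S (T • v) := by
  intro he
  obtain ⟨n, rfl⟩ := Nat.exists_eq_add_of_le' h3
  set e := (n + 3) • v with hedef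
  have he2 := he.2
  have b1 : backLength S (v + v) = n + 2 := by
    have h1 := backLength_le ((IsWordSum.nsmul hv.1 (n + 1)).add (.single he.1)) (g := v + v)
      (by linear_combination (norm := module) he2 - hedef)
    have h2 := hS.backLength_le_succ hv.1 v
    omega
  have b2 : backLength S (e + v) = n + 2 := by
    have h1 := backLength_le (IsWordSum.nsmul hv.1 (n + 2)) (g := e + v)
      (by linear_combination (norm := module) he2 - hedef)
    have h2 := hS.backLength_le_succ he.1 v
    omega
  have hne : v + v ≠ e + v := fun h => hv.ne_of_isInvolution he (add_right_cancel h)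
  have hev : wordLength S (e + v) = 1 ∨ wordLength S (e + v) = 2 := by
    rw [add_comm]; exact hS.wordLength_add hv he.1
  have hor : v + v ∈ S ∨ e + v ∈ S := by
    rcases hS.wordLength_add hv hv.1 with l1 | l1
    · exact .inl (hS.mem_of_wordLength l1)
    rcases hev with l2 | l2
    · exact .inr (hS.mem_of_wordLength l2)
    · exact absurd (hS.eq_of_wordLength_backLength (l1.trans l2.symm) (b1.trans b2.symm)) hne
  rcases hor with hz | hz
  · rcases isRegular_or_isInvolution hz with hz | hz
    · rcases eq_or_block_or_far hv hz with h1 | h1 | h1 | h1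
      · exact hS.ne_zero_of_mem hv.1 (by simpa using h1)
      · exact hb _ h1
      · have := backLength_le (IsWordSum.nsmul hv.1 2) (g := v)
          (by linear_combination (norm := module) h1.double)
        omega
      · have := hT.le h1 ((IsWordSum.nsmul hv.1 n).add (.single he.1))
          (by linear_combination (norm := module) he2 - hedef)
        omega
    · have := hS.backLength_involution hz
      omega
  · rcases isRegular_or_isInvolution hz with hz | hz
    · rcases eq_or_block_or_far hv hz with h1 | h1 | h1 | h1
      · exact hS.ne_zero_of_mem he.1 (by simpa using h1)
      · exact hb _ h1
      · exact hS.ne_zero_of_mem hv.1 (by linear_combination (norm := module) h1.double - he2)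
      · have := hT.le h1 (IsWordSum.nsmul hv.1 (n + 1))
          (by linear_combination (norm := module) he2 - hedef)
        omega
    · exact hv.2 (by linear_combination (norm := module) hz.2 - he2)

/-- If `backLength S u ≤ T` and `u` is not the first letter of a block, then a shortest closed word
through `u` consists of letters `u` and at most one involution. -/
theorem IsThin.nsmul_eq_zero_or_isInvolution (hS : IsThin S) (hT : IsFarBound S T)
    (hu : IsRegular S u) (hb : ∀ c, ¬ IsBlock S u c) (hk : backLength S u ≤ T) :
    (backLength S u + 1) • u = 0 ∨ IsInvolution S (backLength S u • u) := by
  by_cases hc : ∃ c, IsBlock S c u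
  · obtain ⟨c, hc⟩ := hc
    exact .inl hc.order
  push Not at hc
  obtain ⟨l, hl, hlS, hls⟩ := hS.isWordSum_backLength u
  have hlet : ∀ z ∈ l, z = u ∨ z = u ∨ IsInvolution S z := by
    intro z hz
    rcases isRegular_or_isInvolution (hlS z hz) with hr | hi
    · rcases eq_or_block_or_far hu hr with h1 | h1 | h1 | h1
      · exact .inl h1
      · exact absurd h1 (hb z)
      · exact absurd h1 (hc z)
      · obtain ⟨l₁, l₂, rfl⟩ := List.append_of_mem hz
        have := hT.le h1 (w := (l₁ ++ l₂).sum) ⟨l₁ ++ l₂, rfl, fun z hz => hlS z (by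
            simp only [List.mem_append, List.mem_cons] at hz ⊢; tauto), rfl⟩ (by
            have h0 : u + (l₁ ++ z :: l₂).sum = 0 := by rw [hls, add_neg_cancel]
            rw [← h0]
            simp only [List.sum_append, List.sum_cons]
            abel)
        simp only [List.length_append, List.length_cons] at hl this
        omega
    · exact .inr (.inr hi)
  obtain ⟨x, y, ε, f, hf, hs, hn⟩ := hS.exists_normalForm u u l hlet
  rw [hls] at hs
  have h1 := backLength_le (((IsWordSum.nsmul hu.1 x).add (.nsmul hu.1 y)).add hf.isWordSum) (g := u)
    (by rw [hs, add_neg_cancel])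
  have h2 : backLength S u = x + y + ε := by omega
  rcases hf with ⟨rfl, rfl⟩ | ⟨rfl, hf⟩
  · left
    rw [h2]
    linear_combination (norm := module) hs
  · right
    rw [h2]
    have h3 : (x + y + 1) • u = f := by linear_combination (norm := module) hs - hf.2
    rwa [h3]

namespace IsExtremal

variable (h : IsExtremal S T u v x y ε f) (hS : IsThin S)
include h hS

/-- A letter that is repeated in the shortest closed word containing a far pair has back length at
most `T`. Otherwise `2u` is a letter; the ways in which it is related to `v` are excluded in turn. -/
theorem backLength_le (hx : 1 ≤ x) : backLength S u ≤ T := by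
  by_contra! hk
  obtain ⟨x, rfl⟩ := Nat.exists_eq_add_of_le' hx
  have hu := h.far.left
  have hv := h.far.right
  have hcard := h.card
  have hcl := h.closed
  have hT := h.bound
  have h1 : backLength S (u + u) ≤ T :=
    (Digraph.backLength_le (h.isWordSum x (y + 1)) (by rw [← hcl]; module)).trans (by omega)
  have h2 := hS.backLength_le_succ hu.1 u
  have hbu : backLength S u = T + 1 := by omega
  have hbw : backLength S (u + u) = T := by omega
  have hw : u + u ∈ S := by
    rcases hS.wordLength_add hu hu.1 with l1 | l1
    · exact hS.mem_of_wordLength l1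
    · exact absurd (add_left_cancel (hS.eq_of_wordLength_backLength
        (l1.trans (h.wordLength_add hS).symm) (hbw.trans (h.backLength_add).symm))) h.far.ne
  obtain ⟨w, hwdef⟩ : ∃ w, w = u + u := ⟨_, rfl⟩
  rw [← hwdef] at hw hbw
  -- if `u` occurs at least three times, replace two of its occurrences by `w`
  have hx0 : x = 0 := by
    by_contra hx0
    obtain ⟨x, rfl⟩ := Nat.exists_eq_add_of_le' (Nat.one_le_iff_ne_zero.mpr hx0)
    have := hT.le h.far ((IsWordSum.single hw).add (h.isWordSum x y))
      (by linear_combination (norm := module) hcl + hwdef)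
    omega
  subst hx0
  rcases isRegular_or_isInvolution hw with hw | hw
  · rcases eq_or_block_or_far hv hw with h3 | h3 | h3 | h3
    · rw [h3] at hwdef hbw
      rcases h.tail with ⟨rfl, rfl⟩ | ⟨rfl, hf⟩
      · refine h.far.not_block ⟨hu, hv, hwdef.symm, ?_, by omega⟩
        rw [hbw, show T = y + 1 by omega]
        linear_combination (norm := module) hcl + hwdef
      · have hTf : T • v = f := by
          rw [show T = y + 2 by omega]
          linear_combination (norm := module) hcl + hwdef - hf.2
        by_cases hy : 1 ≤ y
        · exact hS.not_nsmul_isInvolution hT hv hbw (by omega) (h.symm.not_isBlock hS hy)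
            (by rwa [hTf])
        · obtain rfl : T = 2 := by omega
          have h4 := hS.eq_neg_self ((h.wordLength_add hS).trans (h.backLength_add).symm)
          refine hS.ne_zero_of_mem hv.1 ?_
          linear_combination (norm := module) 2 • hTf + hf.2 - h4 - hwdef
    · have hy : ¬ 1 ≤ y := fun hy => h.symm.not_isBlock hS hy w h3
      obtain rfl : y = 0 := by omega
      exact hS.add_tail_ne_zero hv hw h3.ne h.tail
        (by linear_combination (norm := module) hcl + hwdef)
    · have hord := h3.order
      have hTv : T = backLength S v + 1 := hbw.symm.trans h3.back
      rw [← hTv] at hord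
      rcases h.tail with ⟨rfl, rfl⟩ | ⟨rfl, hf⟩
      · obtain rfl : T = y + 1 := by omega
        refine hS.ne_zero_of_mem hw.1 ?_
        linear_combination (norm := module) hcl + hwdef - hord
      · obtain rfl : T = y + 2 := by omega
        -- `w + f = v` and `2w = v`
        refine hS.ne_zero_of_mem hv.1 ?_
        linear_combination (norm := module) 2 • hord + hf.2 + h3.double - 2 • hcl - 2 • hwdef
    · have := hT.le h3 (h.isWordSum 0 y) (by linear_combination (norm := module) hcl + hwdef)
      omega
  · have := hS.backLength_involution hw
    obtain rfl : y = 0 := by omega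
    obtain rfl : ε = 0 := by omega
    rcases h.tail with ⟨-, rfl⟩ | ⟨h0, -⟩
    · exact hS.add_ne_zero_of_mem hv hw.1 (by linear_combination (norm := module) hcl + hwdef)
    · omega

theorem nsmul_eq_zero_or_isInvolution (hx : 1 ≤ x) :
    (backLength S u + 1) • u = 0 ∨ IsInvolution S (backLength S u • u) :=
  hS.nsmul_eq_zero_or_isInvolution h.bound h.far.left (h.not_isBlock hS hx) (h.backLength_le hS hx)

omit h in
/-- If `(T + 1) • v = 0` for a letter `v` with `backLength S v = T`, and `e` is an involution in `S`,
then `u = v + e` is not a letter: it would close up with fewer than `T` letters, and such a word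
yields a closed word through `v` that is too short. -/
theorem _root_.Digraph.IsThin.not_twin (hT : IsFarBound S T) {e : A} (he : IsInvolution S e)
    (hu : IsRegular S u) (hv : IsRegular S v) (huv : u = v + e) (hord : (T + 1) • v = 0)
    (hk : backLength S v = T) : False := by
  have he2 := he.2
  have hk2 := hS.two_le_backLength hv
  have hm2 := hS.two_le_backLength hu
  have hne : backLength S u ≠ backLength S v := fun h0 => by
    rw [hS.eq_of_backLength hu.1 hv.1 h0] at huv
    exact hS.ne_zero_of_mem he.1 (by simpa using huv)
  have hle : backLength S u ≤ T := by
    obtain ⟨j, rfl⟩ := Nat.exists_eq_add_of_le' (show 1 ≤ T by omega)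
    refine (Digraph.backLength_le ((IsWordSum.single hu.1).add (.nsmul hv.1 j)) ?_).trans
      (by omega)
    linear_combination (norm := module) hord + 2 • huv + he2
  have hlt : backLength S u < T := by omega
  obtain ⟨m, hm⟩ : ∃ m, backLength S u = m + 1 := ⟨backLength S u - 1, by omega⟩
  have hword := hS.isWordSum_backLength u
  rw [hm] at hword
  obtain ⟨c, hc, r, hr, hcr⟩ := isWordSum_succ.mp hword
  rcases isRegular_or_isInvolution hc with hc | hc
  · rcases eq_or_block_or_far hu hc with h1 | h1 | h1 | h1
    · subst h1
      have := Digraph.backLength_le ((IsWordSum.single hv.1).add hr) (g := v)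
        (by linear_combination (norm := module) -hcr - 2 • huv - he2)
      omega
    · have h2 := hS.two_le_backLength hc
      have h3 := h1.back
      have h4 := h1.order
      have h5 := Digraph.backLength_le ((IsWordSum.single hu.1).add ((IsWordSum.single hv.1).add hr))
        (g := v) (by linear_combination (norm := module) h1.double - hcr - 2 • huv - he2)
      obtain rfl : T = m + 2 := by omega
      rw [← h3, hm] at h4
      have h6 := Digraph.backLength_le (IsWordSum.nsmul hv.1 3) (g := v) (by
        linear_combination (norm := module) 2 • hord - h4
          + ((m : ℤ) + 1) • (-h1.double + 2 • huv + he2))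
      omega
    · have h2 := h1.order
      rw [hm] at h2
      have := Digraph.backLength_le ((IsWordSum.single hv.1).add (.nsmul hu.1 m)) (g := v)
        (by linear_combination (norm := module) h2 - 2 • huv - he2)
      omega
    · have := hT.le h1 hr (by linear_combination (norm := module) -hcr)
      omega
  · rw [hS.involution_unique hc he] at hcr
    have := Digraph.backLength_le hr (g := v)
      (by linear_combination (norm := module) -hcr - huv - he2)
    omega

/-- Both letters of the far pair are repeated in the shortest closed word. -/
theorem one_le_left : 1 ≤ x := by
  by_contra hx
  obtain rfl : x = 0 := by omega
  have hu := h.far.left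
  have hv := h.far.right
  have hcard := h.card
  have hcl := h.closed
  have hT := h.bound
  have hε := h.tail.le_one
  rcases Nat.eq_zero_or_pos y with rfl | hy
  · exact hS.add_tail_ne_zero hu hv h.far.ne h.tail (by simpa using hcl)
  have hk := h.symm.backLength_le hS hy
  have hk2 := hS.two_le_backLength hv
  have hf2 := h.tail.add_self
  rcases h.symm.nsmul_eq_zero_or_isInvolution hS hy with h1 | h1
  · generalize hkk : backLength S v = k at *
    rcases lt_trichotomy y k with h2 | rfl | h2
    · obtain rfl : k = y + 1 := by omega
      rcases h.tail with ⟨rfl, -⟩ | ⟨rfl, hf⟩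
      · omega
      · refine hS.not_twin hT hf hu hv ?_ (T := T) ?_ (by omega)
        · linear_combination (norm := module) hcl - h1 - hf2
        · rw [show T = y + 1 by omega, h1]
    · refine hS.tail_ne hu h.tail ?_
      linear_combination (norm := module) hcl - h1 - hf2
    · obtain ⟨j, rfl⟩ := Nat.exists_eq_add_of_lt h2
      have := hT.le h.far (h.isWordSum 0 j) (by linear_combination (norm := module) hcl - h1)
      omega
  · obtain ⟨δ, hδ, hd⟩ := hS.tail_add h.tail h1.tail
    have h12 := h1.2
    generalize hkk : backLength S v = k at *
    rcases lt_or_ge y k with h2 | h2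
    · obtain rfl : k = y + 1 := by omega
      refine hS.tail_ne hu hd ?_
      linear_combination (norm := module) hcl - hf2 - h12
    · obtain ⟨j, rfl⟩ := Nat.exists_eq_add_of_le h2
      have := hT.le h.far ((IsWordSum.nsmul hv.1 j).add hd.isWordSum)
        (by linear_combination (norm := module) hcl)
      omega

theorem one_le_right : 1 ≤ y := h.symm.one_le_left hS

theorem three_le : 3 ≤ T := by
  have h1 := h.backLength_le hS (h.one_le_left hS)
  have h2 := h.symm.backLength_le hS (h.one_le_right hS)
  have h3 := hS.two_le_backLength h.far.left
  have h4 := hS.two_le_backLength h.far.right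
  by_contra! h5
  exact h.far.ne (hS.eq_of_backLength h.far.left.1 h.far.right.1 (by omega))

theorem add_self_ne {w : A} (hw : IsFar S u w) : u + u ≠ w := by
  intro huw
  have hk := h.backLength_le hS (h.one_le_left hS)
  have hk2 := hS.two_le_backLength h.far.left
  have hu := h.far.left.1
  obtain ⟨k, hkk⟩ := Nat.exists_eq_add_of_le' hk2
  rcases h.nsmul_eq_zero_or_isInvolution hS (h.one_le_left hS) with h1 | h1
  · rw [hkk] at h1
    have := h.bound.le hw (.nsmul hu k) (by linear_combination (norm := module) h1 - huw)
    omega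
  · rw [hkk] at h1
    rcases Nat.eq_zero_or_pos k with rfl | h0
    · rw [zero_add, two_nsmul, huw] at h1
      exact hw.right.2 h1.2
    · obtain ⟨k, rfl⟩ := Nat.exists_eq_add_of_le' h0
      have := h.bound.le hw ((IsWordSum.nsmul hu k).add (.single h1.1))
        (by linear_combination (norm := module) h1.2 - huw)
      omega

/-- If `2u` were an involution in `S`, then `(y + 1) • v` would be either `2u` or `0`; the first case
is `IsThin.not_nsmul_isInvolution`, and in the second case `u + 2v` and `u + 2u + v` are too close
to each other. -/
theorem not_add_self_isInvolution (hx : x = 1) : ¬ IsInvolution S (u + u) := by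
  subst hx
  intro he
  have hu := h.far.left
  have hv := h.far.right
  have hcard := h.card
  have hcl := h.closed
  have hT := h.bound
  have hT3 := h.three_le hS
  obtain ⟨y, rfl⟩ := Nat.exists_eq_add_of_le' (h.one_le_right hS)
  obtain ⟨e, hedef⟩ : ∃ e, e = u + u := ⟨_, rfl⟩
  rw [← hedef] at he
  have he2 := he.2
  rcases h.tail with ⟨rfl, rfl⟩ | ⟨rfl, hf⟩
  · have hk := h.symm.backLength_le hS (by omega)
    obtain rfl : T = y + 2 := by omega
    have hTe : (y + 2) • v = e := by linear_combination (norm := module) hcl + hedef - he2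
    have hkT : backLength S v = y + 2 := by
      by_contra hkT
      rcases h.symm.nsmul_eq_zero_or_isInvolution hS (by omega) with h1 | h1
      · generalize hkk : backLength S v = k at *
        rcases (show k = y + 1 ∨ k ≤ y by omega) with rfl | h2
        · exact hS.ne_zero_of_mem he.1 (by linear_combination (norm := module) h1 - hTe)
        · obtain ⟨j, rfl⟩ := Nat.exists_eq_add_of_le h2
          have := hT.le h.far (h.isWordSum 1 j) (by linear_combination (norm := module) hcl - h1)
          omega
      · have hk2 := hS.two_le_backLength hv
        have h2 := hS.involution_unique h1 he
        obtain ⟨k, hkk⟩ := Nat.exists_eq_add_of_le' hk2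
        rw [hkk] at h2
        have := hT.le h.far (h.isWordSum 1 (k + 1))
          (by linear_combination (norm := module) h2 - hedef + he2)
        omega
    exact hS.not_nsmul_isInvolution hT hv hkT hT3 (h.symm.not_isBlock hS (by omega))
      (by rwa [hTe])
  · obtain rfl : e = f := hS.involution_unique he hf
    obtain ⟨y, rfl⟩ : ∃ y', y = y' + 1 := by
      refine Nat.exists_eq_add_of_le' (Nat.one_le_iff_ne_zero.mpr ?_)
      rintro rfl
      exact hv.2 (by linear_combination (norm := module) hcl + hedef - he2)
    have huv := h.backLength_add
    have b1 : backLength S (v + (u + v)) = T - 1 := by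
      have h1 := Digraph.backLength_le (h.isWordSum 1 (y + 1)) (g := v + (u + v))
        (by linear_combination (norm := module) hcl)
      have h2 := hS.backLength_le_succ hv.1 (u + v)
      omega
    have b2 : backLength S (e + (u + v)) = T - 1 := by
      have h1 := Digraph.backLength_le ((IsWordSum.nsmul hu.1 1).add (.nsmul hv.1 (y + 2)))
        (g := e + (u + v)) (by linear_combination (norm := module) hcl)
      have h2 := hS.backLength_le_succ he.1 (u + v)
      omega
    have huv2 := (IsWordSum.single hu.1).add (.single hv.1)
    have l1 := wordLength_le ((IsWordSum.single hv.1).add huv2)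
    have l2 := wordLength_le ((IsWordSum.single he.1).add huv2)
    have l3 : 3 ≤ wordLength S (v + (u + v)) := by
      have := hT.le h.far ((hS.isWordSum (v + (u + v))).add (h.isWordSum 0 y))
        (by linear_combination (norm := module) hcl)
      omega
    have l4 : 3 ≤ wordLength S (e + (u + v)) := by
      have := hT.le h.far ((hS.isWordSum (e + (u + v))).add (.nsmul hv.1 (y + 1)))
        (by linear_combination (norm := module) hcl)
      omega
    exact hv.ne_of_isInvolution he (add_right_cancel
      (hS.eq_of_wordLength_backLength (by omega) (b1.trans b2.symm)))

theorem three_le_wordLength : 3 ≤ wordLength S (u + (u + v)) := by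
  by_contra! hlt
  have hu := h.far.left
  have hv := h.far.right
  have hcard := h.card
  have hcl := h.closed
  have hT := h.bound
  have hT3 := h.three_le hS
  have hword := hS.isWordSum (u + (u + v))
  have hnb := h.symm.not_isBlock hS (h.one_le_right hS)
  obtain ⟨x, rfl⟩ := Nat.exists_eq_add_of_le' (h.one_le_left hS)
  obtain ⟨y, rfl⟩ := Nat.exists_eq_add_of_le' (h.one_le_right hS)
  have hx0 : x = 0 := by
    by_contra hx0
    obtain ⟨x, rfl⟩ := Nat.exists_eq_add_of_le' (Nat.one_le_iff_ne_zero.mpr hx0)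
    have := hT.le h.far (hword.add (h.isWordSum x y)) (by rw [← hcl]; module)
    omega
  subst hx0
  have h20 : u + (u + v) ≠ 0 := fun h0 => by
    have := hT.le h.far (.single hu.1) (by rw [← h0]; abel)
    omega
  -- the letters of a word with at most two letters and with the sum `2u + v`
  have letter : ∀ c ∈ S, ∀ r n, IsWordSum S n r → n ≤ 1 → c + r = u + (u + v) →
      c = v ∨ IsBlock S c v ∨ IsInvolution S c := by
    intro c hc r n hr hn hcr
    rcases isRegular_or_isInvolution hc with hc | hc
    · rcases eq_or_block_or_far hv hc with h1 | h1 | h1 | h1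
      · exact .inl h1
      · exact absurd h1 (hnb c)
      · exact .inr (.inl h1)
      · have := hT.le h1 (hr.add (h.isWordSum 0 y))
          (by linear_combination (norm := module) hcl + hcr)
        omega
    · exact .inr (.inr hc)
  have far : ∀ c, IsBlock S c v → IsFar S u c := fun c hc =>
    (hS.far_of_block (.inr hc) h.far.symm).symm
  have double : ∀ c, c = v ∨ IsBlock S c v ∨ IsInvolution S c → u + u ≠ c := by
    rintro c (rfl | hc | hc) h0
    · exact h.add_self_ne hS h.far h0
    · exact h.add_self_ne hS (far c hc) h0
    · exact h.not_add_self_isInvolution hS rfl (by rwa [h0])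
  have mixed : ∀ c e, IsBlock S c v → IsInvolution S e → c + e ≠ u + (u + v) := by
    intro c e hc he h0
    have := hT.le (far c hc) ((IsWordSum.single hu.1).add (.single he.1))
      (by linear_combination (norm := module) he.2 - h0 + hc.double)
    omega
  generalize hj : wordLength S (u + (u + v)) = j at *
  rcases (show j = 0 ∨ j = 1 ∨ j = 2 by omega) with rfl | rfl | rfl
  · exact h20 (isWordSum_zero_iff.mp hword)
  · have hc := isWordSum_one_iff.mp hword
    rcases letter _ hc 0 0 .zero (by omega) (add_zero _) with h1 | h1 | h1
    · exact hu.2 (by linear_combination (norm := module) h1)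
    · have := hT.le (far _ h1) (.single hu.1) (by linear_combination (norm := module) h1.double)
      omega
    · have := hT.le h.far ((IsWordSum.single hu.1).add (.single h1.1))
        (by linear_combination (norm := module) h1.2)
      omega
  · obtain ⟨c, hc, c', hc', h0⟩ := isWordSum_succ.mp hword
    have hcS := isWordSum_one_iff.mp hc'
    have L := letter c hc c' 1 hc' le_rfl h0.symm
    have L' := letter c' hcS c 1 (.single hc) le_rfl (by rw [add_comm, h0])
    rcases L with rfl | h1 | h1
    · exact double c' L' (by linear_combination (norm := module) h0)
    · rcases L' with rfl | h2 | h2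
      · exact double c (.inr (.inl h1)) (by linear_combination (norm := module) h0)
      · obtain rfl := hS.block_left_unique h1 h2
        exact hu.2 (by linear_combination (norm := module) h0 + h1.double)
      · exact mixed c c' h1 h2 h0.symm
    · rcases L' with rfl | h2 | h2
      · exact double c (.inr (.inr h1)) (by linear_combination (norm := module) h0)
      · exact mixed c' c h2 h1 (by rw [add_comm, h0])
      · obtain rfl := hS.involution_unique h1 h2
        exact h20 (h0.trans h1.2)

/-- There is no far pair: `2u + v` and `u + 2v` would both be at distance `3` from `0` and at distance
`T - 1` to `0`. -/
theorem false : False := by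
  have hu := h.far.left
  have hv := h.far.right
  have huv := h.backLength_add
  have hT3 := h.three_le hS
  have back : ∀ {x y : ℕ} {u v : A}, IsExtremal S T u v x y ε f →
      backLength S (u + (u + v)) = T - 1 ∧ wordLength S (u + (u + v)) = 3 := by
    intro x y u v h
    obtain ⟨x, rfl⟩ := Nat.exists_eq_add_of_le' (h.one_le_left hS)
    have h1 := Digraph.backLength_le (h.isWordSum x y) (g := u + (u + v))
      (by rw [← h.closed]; module)
    have h2 := hS.backLength_le_succ h.far.left.1 (u + v)
    have h3 := h.three_le_wordLength hS
    have h4 := wordLength_le ((IsWordSum.single h.far.left.1).add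
      ((IsWordSum.single h.far.left.1).add (.single h.far.right.1)))
    have h5 := h.card
    have h6 := h.backLength_add
    omega
  obtain ⟨b1, l1⟩ := back h
  obtain ⟨b2, l2⟩ := back h.symm
  have h1 := hS.eq_of_wordLength_backLength (l1.trans l2.symm) (b1.trans b2.symm)
  rw [add_comm v u] at h1
  exact h.far.ne (add_right_cancel h1)

end IsExtremal

theorem IsThin.not_isFar (hS : IsThin S) (u v : A) : ¬ IsFar S u v := by
  classical
  intro huv
  have hex : ∃ T, ∃ u v, IsFar S u v ∧ backLength S (u + v) = T := ⟨_, u, v, huv, rfl⟩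
  obtain ⟨u, v, huv, h⟩ := Nat.find_spec hex
  obtain ⟨x, y, ε, f, hext⟩ := hS.exists_isExtremal
    (fun u v huv => Nat.find_min' hex ⟨u, v, huv, rfl⟩) huv h
  exact hext.false hS

end Extremal

end Digraph

/-! ### Classification of thin sets in abelian groups -/

namespace Digraph

section Classification

theorem isIsomorphic_addCayley_of_image {A B : Type*} [AddGroup A] [AddGroup B] {S : Set A}
    {R : Set B} (φ : B ≃+ A) (h : φ '' R = S) : (addCayley S).IsIsomorphic (addCayley R) := by
  subst h
  refine ⟨⟨φ.symm.toEquiv, ?_⟩⟩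
  intro x y
  change (∃ s ∈ R, φ.symm y = φ.symm x + s) ↔ ∃ s ∈ φ '' R, y = x + s
  constructor
  · rintro ⟨s, hs, h⟩
    exact ⟨φ s, ⟨s, hs, rfl⟩, by
      have := congrArg φ h
      simpa using this⟩
  · rintro ⟨_, ⟨s, hs, rfl⟩, rfl⟩
    exact ⟨s, hs, by simp⟩

variable {A : Type*} [AddCommGroup A] {S : Set A}

/-- The homomorphism `ℤₙ → A` that sends `1` to an element `a` with `n • a = 0`. -/
def zmodHom {a : A} {n : ℕ} (h : n • a = 0) : ZMod n →+ A :=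
  ZMod.lift n ⟨zmultiplesHom A a, by simpa using h⟩

theorem zmodHom_natCast {a : A} {n : ℕ} (h : n • a = 0) (k : ℕ) : zmodHom h (k : ZMod n) = k • a := by
  have := ZMod.lift_coe n ⟨zmultiplesHom A a, by simpa using h⟩ (k : ℤ)
  simpa [zmodHom] using this

theorem zmodHom_one {a : A} {n : ℕ} (h : n • a = 0) : zmodHom h 1 = a := by
  simpa using zmodHom_natCast h 1

theorem zmodHom_two {a : A} {n : ℕ} (h : n • a = 0) : zmodHom h 2 = a + a := by
  simpa [two_nsmul] using zmodHom_natCast h 2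

theorem zmodHom_apply {a : A} {n : ℕ} [NeZero n] (h : n • a = 0) (x : ZMod n) :
    zmodHom h x = x.val • a := by
  rw [← zmodHom_natCast h, ZMod.natCast_zmod_val]

theorem zmodHom_injective {a : A} {n : ℕ} [NeZero n] (h : n • a = 0) (hn : addOrderOf a = n) :
    Function.Injective (zmodHom h) := by
  rw [injective_iff_map_eq_zero]
  intro x hx
  rw [zmodHom_apply, ← addOrderOf_dvd_iff_nsmul_eq_zero, hn] at hx
  rw [← ZMod.val_eq_zero]
  exact Nat.eq_zero_of_dvd_of_lt hx x.val_lt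

theorem exists_zmod_addEquiv {a : A} {n : ℕ} [NeZero n] (hn : addOrderOf a = n)
    (hgen : ∀ g, ∃ k : ℕ, k • a = g) : ∃ φ : ZMod n ≃+ A, φ 1 = a ∧ φ 2 = a + a := by
  have h : n • a = 0 := hn ▸ addOrderOf_nsmul_eq_zero a
  refine ⟨AddEquiv.ofBijective (zmodHom h) ⟨zmodHom_injective h hn, fun g => ?_⟩,
    zmodHom_one h, zmodHom_two h⟩
  obtain ⟨k, rfl⟩ := hgen g
  exact ⟨k, zmodHom_natCast h k⟩

theorem exists_zmod_prod_addEquiv {a e : A} {n : ℕ} [NeZero n] (hn : addOrderOf a = n)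
    (he : e + e = 0) (hea : ∀ k : ℕ, k • a ≠ e) (hgen : ∀ g, ∃ k j : ℕ, k • a + j • e = g) :
    ∃ φ : ZMod 2 × ZMod n ≃+ A, φ (1, 0) = e ∧ φ (0, 1) = a ∧ φ (0, 2) = a + a := by
  have h : n • a = 0 := hn ▸ addOrderOf_nsmul_eq_zero a
  have h2 : 2 • e = 0 := (two_nsmul e).trans he
  refine ⟨AddEquiv.ofBijective ((zmodHom h2).coprod (zmodHom h)) ⟨?_, fun g => ?_⟩, ?_, ?_, ?_⟩
  · rw [injective_iff_map_eq_zero]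
    rintro ⟨x, y⟩ hxy
    rw [AddMonoidHom.coprod_apply] at hxy
    have hx : x = 0 := by
      rcases (by decide : ∀ z : ZMod 2, z = 0 ∨ z = 1) x with rfl | rfl
      · rfl
      · exfalso
        refine hea y.val ?_
        rw [zmodHom_one, zmodHom_apply] at hxy
        linear_combination (norm := module) hxy - he
    subst hx
    rw [map_zero, zero_add] at hxy
    rw [(injective_iff_map_eq_zero _).mp (zmodHom_injective h hn) y hxy]
    rfl
  · obtain ⟨k, j, rfl⟩ := hgen g
    exact ⟨(j, k), by simp [zmodHom_natCast, add_comm]⟩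
  · change zmodHom h2 1 + zmodHom h 0 = e
    rw [zmodHom_one, map_zero, add_zero]
  · change zmodHom h2 0 + zmodHom h 1 = a
    rw [zmodHom_one, map_zero, zero_add]
  · change zmodHom h2 0 + zmodHom h 2 = a + a
    rw [zmodHom_two, map_zero, zero_add]

/-- In a block `a`, `b`, the letter `a` has order twice the order of `b`: a word for `-a` in `a` and
`b` has about half as many letters as the order of `a`. -/
theorem IsBlock.addOrderOf_left [Finite A] {a b : A} (hab : IsBlock S a b) :
    addOrderOf a = 2 * (backLength S b + 1) := by
  have hdvd : addOrderOf a ∣ 2 * (backLength S b + 1) := by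
    rw [addOrderOf_dvd_iff_nsmul_eq_zero]
    linear_combination (norm := module) hab.order + ((backLength S b : ℤ) + 1) • hab.double
  have hpos := addOrderOf_pos a
  have h0 := addOrderOf_nsmul_eq_zero a
  obtain ⟨d, hd⟩ := Nat.exists_eq_add_of_le' (Nat.one_le_iff_ne_zero.mpr hpos.ne')
  rw [hd] at h0
  have h1 := backLength_le ((IsWordSum.nsmul hab.right.1 (d / 2)).add (.nsmul hab.left.1 (d % 2)))
    (g := a) (by
      nth_rw 1 [← Nat.div_add_mod d 2] at h0
      linear_combination (norm := module) h0 - ((d / 2 : ℕ) : ℤ) • hab.double)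
  have h2 := hab.back
  have h3 := Nat.le_of_dvd (by omega) hdvd
  omega

namespace IsThin

variable (hS : IsThin S)
include hS

theorem isBlock_or_isBlock {u v : A} (hu : IsRegular S u) (hv : IsRegular S v) (huv : v ≠ u) :
    IsBlock S u v ∨ IsBlock S v u := by
  rcases eq_or_block_or_far hu hv with h | h | h | h
  exacts [absurd h huv, .inl h, .inr h, absurd h (hS.not_isFar u v)]

/-- At most two letters are not involutions, and if there are two, they form a block. -/
theorem regular_cases : (∀ x, ¬ IsRegular S x) ∨
    (∃ a, IsRegular S a ∧ ∀ x, IsRegular S x → x = a) ∨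
    ∃ a b, IsBlock S a b ∧ ∀ x, IsRegular S x → x = a ∨ x = b := by
  by_cases h1 : ∀ x, ¬ IsRegular S x
  · exact .inl h1
  push Not at h1
  obtain ⟨a, ha⟩ := h1
  by_cases h2 : ∀ x, IsRegular S x → x = a
  · exact .inr (.inl ⟨a, ha, h2⟩)
  push Not at h2
  obtain ⟨b, hb, hba⟩ := h2
  have key : ∀ a b, IsBlock S a b → ∀ x, IsRegular S x → x = a ∨ x = b := by
    intro a b hab x hx
    by_contra! hcon
    rcases hS.isBlock_or_isBlock hab.left hx hcon.1 with h | h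
    · exact hcon.2 (h.right_unique hab)
    · exact h.not_chain hab
  rcases hS.isBlock_or_isBlock ha hb hba with h | h
  · exact .inr (.inr ⟨a, b, h, key a b h⟩)
  · exact .inr (.inr ⟨b, a, h, key b a h⟩)

theorem exists_eq_add {a b : A} (hab : ∀ x, IsRegular S x → x = a ∨ x = b) (g : A) :
    ∃ (x y ε : ℕ) (f : A), IsTail S ε f ∧ x • a + y • b + f = g := by
  obtain ⟨l, -, hlS, rfl⟩ := hS.isWordSum g
  obtain ⟨x, y, ε, f, hf, hs, -⟩ := hS.exists_normalForm a b l fun z hz => by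
    rcases isRegular_or_isInvolution (hlS z hz) with h | h
    · rcases hab z h with h | h
      exacts [.inl h, .inr (.inl h)]
    · exact .inr (.inr h)
  exact ⟨x, y, ε, f, hf, hs⟩

theorem nsmul_ne_of_isBlock [Finite A] {a b e : A} (hab : IsBlock S a b)
    (he : IsInvolution S e) (k : ℕ) : k • a ≠ e := by
  intro hk
  have hord := hab.addOrderOf_left
  have hb2 := hS.two_le_backLength hab.right
  have hback := hab.back
  obtain ⟨m, hm⟩ := Nat.exists_eq_add_of_le' hb2
  rw [hm] at hord hback
  have h1 : addOrderOf a ∣ 2 * k := by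
    rw [addOrderOf_dvd_iff_nsmul_eq_zero]
    linear_combination (norm := module) 2 • hk + he.2
  rw [hord] at h1
  obtain ⟨q, hq⟩ := Nat.dvd_of_mul_dvd_mul_left two_pos h1
  have h2 : (2 * (m + 3)) • a = 0 := hord ▸ addOrderOf_nsmul_eq_zero a
  have h3 : (m + 3) • a = e := by
    rcases Nat.even_or_odd' q with ⟨r, rfl | rfl⟩
    · exfalso
      refine hS.ne_zero_of_mem he.1 ?_
      rw [← hk, hq]
      linear_combination (norm := module) r • h2
    · rw [hq] at hk
      linear_combination (norm := module) hk - r • h2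
  have h4 := backLength_le (((IsWordSum.nsmul hab.right.1 ((m + 2) / 2)).add
    (.nsmul hab.left.1 ((m + 2) % 2))).add (.single he.1)) (g := a) (by
      have h5 : (2 * ((m + 2) / 2) + (m + 2) % 2 + 1) • a = e := by
        rw [Nat.div_add_mod, h3]
      linear_combination (norm := module) h5 - (((m + 2) / 2 : ℕ) : ℤ) • hab.double + he.2)
  omega

/-- If the only letter `a` besides an involution `e` generates `e`, then `e = 2a`. -/
theorem eq_two_of_nsmul_eq_isInvolution {a e : A} {d k : ℕ} (hd : addOrderOf a = d)
    (ha : IsRegular S a) (huniq : ∀ x, IsRegular S x → x = a) (he : IsInvolution S e) (hkd : k < d)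
    (hk : k • a = e) : d = 4 ∧ a + a = e := by
  have hk1 : k ≠ 0 := by
    rintro rfl
    exact hS.ne_zero_of_mem he.1 (by simpa using hk.symm)
  have hd2 : d = 2 * k := by
    have h1 : d ∣ 2 * k := by
      rw [← hd, addOrderOf_dvd_iff_nsmul_eq_zero]
      linear_combination (norm := module) 2 • hk + he.2
    obtain ⟨q, hq⟩ := h1
    have hq1 : q = 1 := by
      have : 0 < q := Nat.pos_of_ne_zero fun h0 => by simp [h0] at hq; omega
      by_contra hq1
      have : d * 2 ≤ d * q := Nat.mul_le_mul_left d (by omega)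
      omega
    rw [hq, hq1, mul_one]
  subst hd2
  rcases (show k = 1 ∨ k = 2 ∨ 3 ≤ k by omega) with rfl | rfl | h3
  · exact absurd ((one_nsmul a).symm.trans hk) (ha.ne_of_isInvolution he)
  · exact ⟨rfl, by rw [← two_nsmul, hk]⟩
  · exfalso
    have hT : IsFarBound S k := fun u v huv => absurd huv (hS.not_isFar u v)
    have hb : ∀ c, ¬ IsBlock S a c := fun c hc => hc.ne (huniq c hc.right).symm
    have hle : backLength S a ≤ k := by
      obtain ⟨j, rfl⟩ := Nat.exists_eq_add_of_le' (show 1 ≤ k by omega)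
      exact backLength_le ((IsWordSum.nsmul ha.1 j).add (.single he.1))
        (by linear_combination (norm := module) hk + he.2)
    have hback : backLength S a = k := by
      rcases hS.nsmul_eq_zero_or_isInvolution hT ha hb hle with h | h
      · rw [← addOrderOf_dvd_iff_nsmul_eq_zero, hd] at h
        have := Nat.le_of_dvd (by omega) h
        omega
      · have h1 := hS.involution_unique h he
        rw [← hk] at h1
        exact nsmul_injOn_Iio_addOrderOf (by simp only [Set.mem_Iio, hd]; omega)
          (by simp only [Set.mem_Iio, hd]; omega) h1
    exact hS.not_nsmul_isInvolution hT ha hback h3 hb (by rwa [hk])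

theorem isIsomorphic_of_isThin [Finite A] [Nontrivial A] :
    (∃ n : ℕ, 2 ≤ n ∧
        (addCayley S).IsIsomorphic (addCayley ({1} : Set (ZMod n)))) ∨
      (∃ n : ℕ, 2 ≤ n ∧
        (addCayley S).IsIsomorphic (addCayley ({1, 2} : Set (ZMod (2 * n))))) ∨
      (∃ n : ℕ, 3 ≤ n ∧
        (addCayley S).IsIsomorphic (addCayley ({(1, 0), (0, 1)} : Set (ZMod 2 × ZMod n)))) ∨
      (∃ n : ℕ, 3 ≤ n ∧
        (addCayley S).IsIsomorphic
          (addCayley ({(1, 0), (0, 1), (0, 2)} : Set (ZMod 2 × ZMod (2 * n))))) := by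
  -- a single letter
  have cyc : ∀ a, a ∈ S → (∀ x ∈ S, x = a) → ∃ n : ℕ, 2 ≤ n ∧
      (addCayley S).IsIsomorphic (addCayley ({1} : Set (ZMod n))) := by
    intro a ha huniq
    have hpos := addOrderOf_pos a
    have hne : addOrderOf a ≠ 1 := fun h =>
      hS.ne_zero_of_mem ha (AddMonoid.addOrderOf_eq_one_iff.mp h)
    have : NeZero (addOrderOf a) := ⟨hpos.ne'⟩
    obtain ⟨φ, h1, -⟩ := exists_zmod_addEquiv (a := a) rfl fun g => by
      obtain ⟨l, -, hl, rfl⟩ := hS.isWordSum g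
      exact ⟨l.length, by
        rw [List.eq_replicate_of_mem fun x hx => huniq x (hl x hx), List.sum_replicate,
          List.length_replicate]⟩
    refine ⟨_, by omega, isIsomorphic_addCayley_of_image φ ?_⟩
    rw [Set.image_singleton, h1]
    exact Set.eq_of_subset_of_subset (Set.singleton_subset_iff.mpr ha) huniq
  have three : ∀ a, IsRegular S a → 3 ≤ addOrderOf a := by
    intro a ha
    have hpos := addOrderOf_pos a
    have h0 := addOrderOf_nsmul_eq_zero a
    by_contra! h3
    rcases (show addOrderOf a = 1 ∨ addOrderOf a = 2 by omega) with h | h <;> rw [h] at h0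
    · exact hS.ne_zero_of_mem ha.1 (by simpa using h0)
    · exact ha.2 (by rwa [two_nsmul] at h0)
  rcases hS.regular_cases with hreg | ⟨a, ha, hreg⟩ | ⟨a, b, hab, hreg⟩
  · left
    have hSne : ∃ e, e ∈ S := by
      by_contra! hempty
      obtain ⟨g, hg⟩ := exists_ne (0 : A)
      obtain ⟨l, -, hl, rfl⟩ := hS.isWordSum g
      obtain rfl : l = [] := List.eq_nil_iff_forall_not_mem.mpr fun x hx => hempty x (hl x hx)
      exact hg rfl
    obtain ⟨e, he⟩ := hSne
    have inv : ∀ x ∈ S, IsInvolution S x := fun x hx =>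
      (isRegular_or_isInvolution hx).resolve_left (hreg x)
    exact cyc e he fun x hx => hS.involution_unique (inv x hx) (inv e he)
  · by_cases hinv : ∃ e, IsInvolution S e
    · obtain ⟨e, he⟩ := hinv
      have hSeq : S = {e, a} := by
        ext x
        constructor
        · intro hx
          rcases isRegular_or_isInvolution hx with h | h
          · exact .inr (hreg x h)
          · exact .inl (hS.involution_unique h he)
        · rintro (rfl | rfl)
          exacts [he.1, ha.1]
      have hgen : ∀ g, ∃ k j : ℕ, k • a + j • e = g := by
        intro g
        obtain ⟨x, y, ε, f, hf, rfl⟩ := hS.exists_eq_add (fun x hx => .inl (hreg x hx)) (b := a) g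
        rcases hf with ⟨-, rfl⟩ | ⟨-, hf⟩
        · exact ⟨x + y, 0, by module⟩
        · rw [hS.involution_unique hf he]
          exact ⟨x + y, 1, by module⟩
      have h3 := three a ha
      by_cases hea : ∃ k : ℕ, k • a = e
      · obtain ⟨k, hk⟩ := hea
        obtain ⟨hd, h2⟩ := hS.eq_two_of_nsmul_eq_isInvolution rfl ha hreg he
          (Nat.mod_lt k (addOrderOf_pos a)) (by rw [mod_addOrderOf_nsmul, hk])
        right; left
        obtain ⟨φ, f1, f2⟩ := exists_zmod_addEquiv (n := 2 * 2) hd fun g => by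
          obtain ⟨k', j, rfl⟩ := hgen g
          exact ⟨k' + j * k, by rw [← hk]; module⟩
        refine ⟨2, le_rfl, isIsomorphic_addCayley_of_image φ ?_⟩
        rw [Set.image_insert_eq, Set.image_singleton, f1, f2, h2, hSeq, Set.pair_comm]
      · push Not at hea
        right; right; left
        have : NeZero (addOrderOf a) := ⟨by omega⟩
        obtain ⟨φ, f1, f2, -⟩ := exists_zmod_prod_addEquiv (a := a) rfl he.2 hea hgen
        refine ⟨_, h3, isIsomorphic_addCayley_of_image φ ?_⟩
        rw [Set.image_insert_eq, Set.image_singleton, f1, f2, hSeq]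
    · left
      refine cyc a ha.1 fun x hx => hreg x ?_
      exact (isRegular_or_isInvolution hx).resolve_right fun h => hinv ⟨x, h⟩
  · have hord := hab.addOrderOf_left
    have hb2 := hS.two_le_backLength hab.right
    have : NeZero (2 * (backLength S b + 1)) := ⟨by omega⟩
    by_cases hinv : ∃ e, IsInvolution S e
    · obtain ⟨e, he⟩ := hinv
      obtain ⟨φ, f1, f2, f3⟩ := exists_zmod_prod_addEquiv hord he.2
        (hS.nsmul_ne_of_isBlock hab he) fun g => by
          obtain ⟨x, y, ε, f, hf, rfl⟩ := hS.exists_eq_add hreg g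
          rw [← hab.double]
          rcases hf with ⟨-, rfl⟩ | ⟨-, hf⟩
          · exact ⟨x + 2 * y, 0, by module⟩
          · rw [hS.involution_unique hf he]
            exact ⟨x + 2 * y, 1, by module⟩
      right; right; right
      refine ⟨_, by omega, isIsomorphic_addCayley_of_image φ ?_⟩
      rw [Set.image_insert_eq, Set.image_insert_eq, Set.image_singleton, f1, f2, f3, hab.double]
      ext x
      constructor
      · rintro (rfl | rfl | rfl)
        exacts [he.1, hab.left.1, hab.right.1]
      · intro hx
        rcases isRegular_or_isInvolution hx with h | h
        · exact .inr (hreg x h)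
        · exact .inl (hS.involution_unique h he)
    · obtain ⟨φ, f1, f2⟩ := exists_zmod_addEquiv hord fun g => by
        obtain ⟨x, y, ε, f, hf, rfl⟩ := hS.exists_eq_add hreg g
        rcases hf with ⟨-, rfl⟩ | ⟨-, hf⟩
        · exact ⟨x + 2 * y, by rw [← hab.double]; module⟩
        · exact absurd ⟨f, hf⟩ hinv
      right; left
      refine ⟨_, by omega, isIsomorphic_addCayley_of_image φ ?_⟩
      rw [Set.image_insert_eq, Set.image_singleton, f1, f2, hab.double]
      ext x
      constructor
      · rintro (rfl | rfl)
        exacts [hab.left.1, hab.right.1]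
      · intro hx
        exact hreg x ((isRegular_or_isInvolution hx).resolve_right fun h => hinv ⟨x, h⟩)

end IsThin

end Classification

end Digraph

/-! ### Weakly resolving vertices and Cayley digraphs -/

namespace Digraph

section Cayley

theorem weakMetricDim_eq_one_iff {V : Type*} [Nontrivial V] (Γ : Digraph V) :
    Γ.weakMetricDim = 1 ↔ ∃ w, ∀ u v, Γ.twoWayDist w u = Γ.twoWayDist w v → u = v := by
  constructor
  · intro h
    have hne : {k | ∃ S : Finset V, S.card = k ∧ Γ.IsWeaklyResolving S}.Nonempty := by
      rw [Set.nonempty_iff_ne_empty]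
      intro h0
      rw [weakMetricDim, h0, Nat.sInf_empty] at h
      omega
    obtain ⟨S, hS, hres⟩ := Nat.sInf_mem hne
    rw [← weakMetricDim, h, Finset.card_eq_one] at hS
    obtain ⟨w, rfl⟩ := hS
    refine ⟨w, fun u v huv => ?_⟩
    by_contra hne
    obtain ⟨w', hw', h'⟩ := hres u v hne
    rw [Finset.mem_singleton.mp hw'] at h'
    exact h' huv
  · rintro ⟨w, hw⟩
    have h1 : Γ.weakMetricDim ≤ 1 := Nat.sInf_le ⟨{w}, Finset.card_singleton w, fun u v huv =>
      ⟨w, Finset.mem_singleton_self w, fun h => huv (hw u v h)⟩⟩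
    have h0 : Γ.weakMetricDim ≠ 0 := by
      intro h0
      rcases Nat.sInf_eq_zero.mp h0 with ⟨S, hS, hres⟩ | h
      · obtain ⟨u, v, huv⟩ := exists_pair_ne V
        obtain ⟨w', hw', -⟩ := hres u v huv
        rw [Finset.card_eq_zero.mp hS] at hw'
        simp at hw'
      · exact Set.eq_empty_iff_forall_notMem.mp h 1 ⟨{w}, Finset.card_singleton w, fun u v huv =>
          ⟨w, Finset.mem_singleton_self w, fun h => huv (hw u v h)⟩⟩
    omega

section Iso

variable {V W : Type*} {Γ : Digraph V} {Δ : Digraph W} (σ : Γ.Adj ≃r Δ.Adj)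

theorem hasWalk_map_iff (n : ℕ) (x y : V) : Δ.HasWalk n (σ x) (σ y) ↔ Γ.HasWalk n x y := by
  induction n generalizing y with
  | zero => exact σ.injective.eq_iff
  | succ n ih =>
    constructor
    · rintro ⟨z, hz, h⟩
      obtain ⟨z, rfl⟩ := σ.surjective z
      exact ⟨z, (ih z).mp hz, σ.map_rel_iff.mp h⟩
    · rintro ⟨z, hz, h⟩
      exact ⟨σ z, (ih z).mpr hz, σ.map_rel_iff.mpr h⟩

theorem dist_map (x y : V) : Δ.dist (σ x) (σ y) = Γ.dist x y := by
  simp only [dist, hasWalk_map_iff]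

theorem twoWayDist_map (x y : V) : Δ.twoWayDist (σ x) (σ y) = Γ.twoWayDist x y := by
  simp only [twoWayDist, dist_map]

end Iso

section AddGroup

variable {A : Type*} [AddGroup A] {S : Set A}

theorem hasWalk_addCayley_iff (n : ℕ) (x y : A) :
    (addCayley S).HasWalk n x y ↔ IsWordSum S n (-x + y) := by
  induction n generalizing y with
  | zero =>
    rw [isWordSum_zero_iff, neg_add_eq_zero]
    exact Iff.rfl
  | succ n ih =>
    rw [isWordSum_succ']
    constructor
    · rintro ⟨z, hz, s, hs, rfl⟩
      refine ⟨-x + z, (ih z).mp hz, ?_⟩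
      simpa [← add_assoc] using hs
    · rintro ⟨h, hh, hs⟩
      refine ⟨x + h, (ih _).mpr (by simpa using hh), _, hs, ?_⟩
      simp [add_assoc]

theorem dist_addCayley (x y : A) : (addCayley S).dist x y = wordLength S (-x + y) := by
  simp only [dist, wordLength, hasWalk_addCayley_iff]

theorem twoWayDist_addCayley_zero (x : A) :
    (addCayley S).twoWayDist 0 x = (wordLength S x, wordLength S (-x)) := by
  simp [twoWayDist, dist_addCayley]

theorem weakMetricDim_of_isIsomorphic {V : Type*} [Nontrivial V] {Γ : Digraph V}
    (h : Γ.IsIsomorphic (addCayley S))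
    (hS : ∀ g h, wordLength S g = wordLength S h → wordLength S (-g) = wordLength S (-h) → g = h) :
    Γ.weakMetricDim = 1 := by
  obtain ⟨σ⟩ := h
  rw [weakMetricDim_eq_one_iff]
  refine ⟨σ.symm 0, fun u v huv => σ.injective ?_⟩
  rw [← twoWayDist_map σ, ← twoWayDist_map σ, σ.apply_symm_apply, twoWayDist_addCayley_zero,
    twoWayDist_addCayley_zero, Prod.mk.injEq] at huv
  exact hS _ _ huv.1 huv.2

end AddGroup

/-- If a vertex `w` alone is weakly resolving, then only the identity automorphism fixes `w`, so that
`Γ` is a Cayley digraph of its automorphism group. -/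
theorem exists_isThin {V : Type*} [Nontrivial V] {Γ : Digraph V}
    (hsimple : ∀ x, ¬ Γ.Adj x x) (hconn : Γ.StronglyConnected) (hvt : Γ.IsVertexTransitive)
    (hdim : Γ.weakMetricDim = 1) : ∃ S : Set (Additive (Γ.Adj ≃r Γ.Adj)),
      IsThin S ∧ Nonempty (Γ.Adj ≃r (addCayley S).Adj) := by
  obtain ⟨w, hw⟩ := (weakMetricDim_eq_one_iff Γ).mp hdim
  let S : Set (Additive (Γ.Adj ≃r Γ.Adj)) := {g | Γ.Adj w (g.toMul w)}
  have hinj : Function.Injective fun g : Additive (Γ.Adj ≃r Γ.Adj) => g.toMul w := by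
    intro g h hgh
    have hfix : ((-g + h).toMul : Γ.Adj ≃r Γ.Adj) w = w := by
      change g.toMul⁻¹ (h.toMul w) = w
      rw [← show g.toMul w = h.toMul w from hgh]
      exact g.toMul.symm_apply_apply w
    have h1 : -g + h = 0 := by
      refine RelIso.ext fun u => ?_
      refine (hw _ _ ?_ : u = (-g + h).toMul u).symm
      nth_rw 2 [← hfix]
      exact (twoWayDist_map _ w u).symm
    exact neg_add_eq_zero.mp h1
  let e : Additive (Γ.Adj ≃r Γ.Adj) ≃ V :=
    Equiv.ofBijective (fun g => g.toMul w) ⟨hinj, fun x => hvt w x⟩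
  let σ : (addCayley S).Adj ≃r Γ.Adj := ⟨e, by
    intro g h
    change Γ.Adj (g.toMul w) (h.toMul w) ↔ ∃ s ∈ S, h = g + s
    constructor
    · intro hadj
      refine ⟨-g + h, ?_, by simp⟩
      change Γ.Adj w (g.toMul⁻¹ (h.toMul w))
      rw [← g.toMul.map_rel_iff]
      exact (g.toMul.apply_symm_apply (h.toMul w)).symm ▸ hadj
    · rintro ⟨s, hs, rfl⟩
      exact g.toMul.map_rel_iff.mpr hs⟩
  have hσ0 : σ 0 = w := rfl
  refine ⟨S, ⟨fun h0 => hsimple w h0, fun g => ?_, fun g h h1 h2 => σ.injective (hw _ _ ?_)⟩,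
    ⟨σ.symm⟩⟩
  · obtain ⟨n, hn⟩ := hconn (σ 0) (σ g)
    rw [hasWalk_map_iff, hasWalk_addCayley_iff] at hn
    exact ⟨n, by simpa using hn⟩
  · rw [← hσ0, twoWayDist_map, twoWayDist_map, twoWayDist_addCayley_zero, twoWayDist_addCayley_zero,
      h1, h2]

end Cayley

/-! ### Word lengths in the four families -/

section Families

/-- Conditions on `f` that identify it as the word length with respect to `S`. -/
structure IsLength {A : Type*} [AddGroup A] (S : Set A) (f : A → ℕ) : Prop where
  zero : f 0 = 0
  add_le : ∀ g h, f (g + h) ≤ f g + f h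
  le_one : ∀ s ∈ S, f s ≤ 1
  isWordSum : ∀ g, IsWordSum S (f g) g

theorem IsLength.wordLength_eq {A : Type*} [AddGroup A] {S : Set A} {f : A → ℕ}
    (h : IsLength S f) (g : A) : wordLength S g = f g :=
  Digraph.wordLength_eq h.zero h.add_le h.le_one h.isWordSum g

theorem zmod_val_natCast_le (n k : ℕ) : (k : ZMod n).val ≤ k := by
  rcases Nat.eq_zero_or_pos n with rfl | hn
  · exact (Int.natAbs_natCast k).le
  · rw [ZMod.val_natCast]
    exact Nat.mod_le k n

theorem isLength_singleton (n : ℕ) [NeZero n] : IsLength ({1} : Set (ZMod n)) ZMod.val where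
  zero := ZMod.val_zero
  add_le := ZMod.val_add_le
  le_one := by
    rintro s rfl
    simpa using zmod_val_natCast_le n 1
  isWordSum g := by
    have h := IsWordSum.nsmul (S := ({1} : Set (ZMod n))) (x := 1) rfl g.val
    rwa [nsmul_one, ZMod.natCast_zmod_val] at h

theorem isLength_pair (n : ℕ) [NeZero n] :
    IsLength ({1, 2} : Set (ZMod n)) fun x => (x.val + 1) / 2 where
  zero := by simp
  add_le g h := by
    have := ZMod.val_add_le g h
    omega
  le_one := by
    rintro s (rfl | rfl)
    · have := zmod_val_natCast_le n 1
      rw [Nat.cast_one] at this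
      omega
    · have := zmod_val_natCast_le n 2
      rw [Nat.cast_two] at this
      omega
  isWordSum g := by
    have h := (IsWordSum.nsmul (S := ({1, 2} : Set (ZMod n))) (x := 1) (.inl rfl) (g.val % 2)).add
      (.nsmul (x := 2) (.inr rfl) (g.val / 2))
    have h2 : (g.val % 2) • (1 : ZMod n) + (g.val / 2) • 2 = g := by
      rw [nsmul_one, nsmul_eq_mul]
      conv_rhs => rw [← ZMod.natCast_zmod_val g, ← Nat.mod_add_div g.val 2]
      push_cast
      ring
    rw [h2] at h
    rwa [show (g.val + 1) / 2 = g.val % 2 + g.val / 2 by omega]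

/-- Adding a direct factor of order `2` together with its generator. -/
theorem IsLength.prod {A : Type*} [AddCommGroup A] {S : Set A} {f : A → ℕ} (h : IsLength S f) :
    IsLength (insert (1, 0) ((fun s => (0, s)) '' S) : Set (ZMod 2 × A))
      fun x => x.1.val + f x.2 where
  zero := by simp [h.zero]
  add_le x y := by
    have h1 := ZMod.val_add_le x.1 y.1
    have h2 := h.add_le x.2 y.2
    simp only [Prod.fst_add, Prod.snd_add]
    omega
  le_one := by
    rintro s (rfl | ⟨s, hs, rfl⟩)
    · change (1 : ZMod 2).val + f 0 ≤ 1
      rw [h.zero]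
      exact zmod_val_natCast_le 2 1
    · simpa using h.le_one s hs
  isWordSum x := by
    obtain ⟨l, hl, hlS, hls⟩ := h.isWordSum x.2
    have h1 : IsWordSum (insert (1, 0) ((fun s => (0, s)) '' S) : Set (ZMod 2 × A)) (f x.2)
        (0, x.2) := by
      refine ⟨l.map (AddMonoidHom.inr (ZMod 2) A), by simp [hl], ?_, ?_⟩
      · intro y hy
        obtain ⟨s, hs, rfl⟩ := List.mem_map.mp hy
        exact .inr ⟨s, hlS s hs, rfl⟩
      · rw [← map_list_sum, hls, AddMonoidHom.inr_apply]
    have h2 := (IsWordSum.nsmul (S := insert (1, 0) ((fun s => (0, s)) '' S)) (.inl rfl)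
      x.1.val).add h1
    have h3 : x.1.val • ((1, 0) : ZMod 2 × A) + (0, x.2) = x := by
      ext <;> simp
    rwa [h3] at h2

theorem eq_of_val_eq {n : ℕ} [NeZero n] {g h : ZMod n} (hgh : g.val = h.val) : g = h :=
  ZMod.val_injective n hgh

theorem val_neg_cases {n : ℕ} [NeZero n] (g : ZMod n) :
    g.val = 0 ∧ (-g).val = 0 ∨ 0 < g.val ∧ g.val + (-g).val = n := by
  have hlt := g.val_lt
  by_cases h : g = 0
  · left; simp [h]
  · right
    have := ZMod.neg_val g
    rw [if_neg h] at this
    have := (ZMod.val_ne_zero g).mpr h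
    omega

end Families

end Digraph

open Digraph in
theorem theorem3p2 {V : Type*} [Finite V] (Γ : Digraph V)
    (hsimple : ∀ x, ¬ Γ.Adj x x) (hconn : Γ.StronglyConnected)
    (hvt : Γ.IsVertexTransitive) (hcard : 2 ≤ Nat.card V) :
    Γ.weakMetricDim = 1 ↔
      (∃ n : ℕ, 2 ≤ n ∧
        Γ.IsIsomorphic (Digraph.addCayley ({1} : Set (ZMod n)))) ∨
      (∃ n : ℕ, 2 ≤ n ∧
        Γ.IsIsomorphic (Digraph.addCayley ({1, 2} : Set (ZMod (2 * n))))) ∨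
      (∃ n : ℕ, 3 ≤ n ∧
        Γ.IsIsomorphic (Digraph.addCayley ({(1, 0), (0, 1)} : Set (ZMod 2 × ZMod n)))) ∨
      (∃ n : ℕ, 3 ≤ n ∧
        Γ.IsIsomorphic
          (Digraph.addCayley ({(1, 0), (0, 1), (0, 2)} : Set (ZMod 2 × ZMod (2 * n))))) := by
  have : Nontrivial V := Finite.one_lt_card_iff_nontrivial.mp hcard
  constructor
  · intro hdim
    obtain ⟨S, hS, ⟨σ⟩⟩ := exists_isThin hsimple hconn hvt hdim
    have trans : ∀ {W : Type} {Δ : Digraph W}, (addCayley S).IsIsomorphic Δ → Γ.IsIsomorphic Δ :=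
      fun ⟨τ⟩ => ⟨σ.trans τ⟩
    have : Finite (Additive (Γ.Adj ≃r Γ.Adj)) := Finite.of_equiv V σ.toEquiv
    have : Nontrivial (Additive (Γ.Adj ≃r Γ.Adj)) := σ.symm.toEquiv.nontrivial
    let _ : AddCommGroup (Additive (Γ.Adj ≃r Γ.Adj)) :=
      { (inferInstance : AddGroup (Additive (Γ.Adj ≃r Γ.Adj))) with
        add_comm := hS.add_comm_of_isThin }
    have key := IsThin.isIsomorphic_of_isThin hS
    exact key.imp (fun ⟨n, hn, h⟩ => ⟨n, hn, trans h⟩) <|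
      Or.imp (fun ⟨n, hn, h⟩ => ⟨n, hn, trans h⟩) <|
      Or.imp (fun ⟨n, hn, h⟩ => ⟨n, hn, trans h⟩) (fun ⟨n, hn, h⟩ => ⟨n, hn, trans h⟩)
  · rintro (⟨n, hn, h⟩ | ⟨n, hn, h⟩ | ⟨n, hn, h⟩ | ⟨n, hn, h⟩)
    · have : NeZero n := ⟨by omega⟩
      refine weakMetricDim_of_isIsomorphic h fun g h h1 _ => eq_of_val_eq ?_
      simpa only [(isLength_singleton n).wordLength_eq] using h1
    · have : NeZero (2 * n) := ⟨by omega⟩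
      refine weakMetricDim_of_isIsomorphic h fun g h h1 h2 => eq_of_val_eq ?_
      simp only [(isLength_pair (2 * n)).wordLength_eq] at h1 h2
      have hg := val_neg_cases g
      have hh := val_neg_cases h
      omega
    · have : NeZero n := ⟨by omega⟩
      have hR : ({(1, 0), (0, 1)} : Set (ZMod 2 × ZMod n)) =
          insert (1, 0) ((fun s => (0, s)) '' {1}) := by rw [Set.image_singleton]
      rw [hR] at h
      refine weakMetricDim_of_isIsomorphic h fun g h h1 h2 => ?_
      simp only [(isLength_singleton n).prod.wordLength_eq, Prod.fst_neg, Prod.snd_neg] at h1 h2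
      have hg := val_neg_cases g.2
      have hh := val_neg_cases h.2
      have hg1 := val_neg_cases g.1
      have hh1 := val_neg_cases h.1
      have hg2 := g.1.val_lt
      have hh2 := h.1.val_lt
      exact Prod.ext (eq_of_val_eq (by omega)) (eq_of_val_eq (by omega))
    · have : NeZero (2 * n) := ⟨by omega⟩
      have hR : ({(1, 0), (0, 1), (0, 2)} : Set (ZMod 2 × ZMod (2 * n))) =
          insert (1, 0) ((fun s => (0, s)) '' {1, 2}) := by
        rw [Set.image_insert_eq, Set.image_singleton]
      rw [hR] at h
      refine weakMetricDim_of_isIsomorphic h fun g h h1 h2 => ?_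
      simp only [(isLength_pair (2 * n)).prod.wordLength_eq, Prod.fst_neg, Prod.snd_neg] at h1 h2
      have hg := val_neg_cases g.2
      have hh := val_neg_cases h.2
      have hg1 := val_neg_cases g.1
      have hh1 := val_neg_cases h.1
      have hg2 := g.1.val_lt
      have hh2 := h.1.val_lt
      exact Prod.ext (eq_of_val_eq (by omega)) (eq_of_val_eq (by omega))
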